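/- Let \[ A=\begin{pmatrix}1&1&1\\0&1&0\\0&0&1\end{pmatrix},\quad B=\begin{pmatrix}1&0&0\\1&1&1\\0&0&1\end{pmatrix},\quad C_A=\begin{pmatrix}1&0&0\\0&1&0\\1&0&1\end{pmatrix},\quad C_B=\begin{pmatrix}1&0&0\\0&1&0\\0&1&1\end{pmatrix}, \] and let $G$ be the graph with vertices $1,2$ and edges $1\to1$, $1\to2$, $2\to2$, $2\to1$ carrying the matrices $X_{11}=A$, $X_{12}=C_A$, $X_{22}=B$, $X_{21}=C_B$. The (projectivized) ARC induction $T$ acts on pairs $(v,\lambda)$, where $v\in\{1,2\}$ and $\lambda=(a,b,c)$ lies in the simplex $\Delta=\{a,b,c\ge 0,\ a+b+c=1\}$: at $v=1$ it follows the edge $1\to1$ if $a>b+c$ and the edge $1\to2$ if $a<c$; at $v=2$ it follows the edge $2\to2$ if $b>a+c$ and the edge $2\to1$ if $b<c$; when it follows $v\to v'$, \[ T(v,\lambda)=\bigl(v',\ X_{vv'}^{-1}\lambda/\|X_{vv'}^{-1}\lambda\|_1\bigr). \] In all other cases the induction stops. Let $\mathscr G$ be the set of $(v,\lambda)$ such that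 $a,b,c$ are rationally independent and the induction never stops. The canonical suspension is the suspension semiflow over $T$ on $\mathscr G$ with roof function $r(v,\lambda)=-\log\|X_{vv'}^{-1}\lambda\|_1$. Let $\mu$ be the natural measure: the $T$-invariant probability measure on $\mathscr G$ such that $\mu\times\mathrm{Leb}$, restricted to the region under the graph of $r$ and normalized, is a measure of maximal entropy of the canonical suspension. Denote also by $\mu$ the induced measure on walks $w=(w_0,w_1,\dots)\in\{1,2\}^{\mathbb N}$ along $G$, i.e. its image under the map that sends $(v,\lambda)$ to the sequence of vertices visited by its $T$-orbit. For a walk $w$ put $X_n(w)=X_{w_0w_1}X_{w_1w_2}\cdots X_{w_{n-1}w_n}$. Then for $\mu$-almost every walk $w$ the Lyapunov exponents $\lambda_1,\lambda_2,\lambda_3$ given by \[ \lambda_1=\lim_{n\to\infty}\frac{\log\|X_n(w)\|}{n},\qquad \lambda_1+\lambda_2=\lim_{n\to\infty}\frac{\log\|\wedge^2X_n(w)\|}{n},\qquad \lambda_3=-(\lambda_1+\lambda_2) \] exist, and the second one is negative; moreover the spectrum is Pisot: \[ \lambda_1>0>\lambda_2 . \] If $\mu$ is ergodic for $T$, then $\lambda_1,\lambda_2,\lambda_3$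 are the same for $\mu$-almost every $w$. -/

import Mathlib

open MeasureTheory Filter Topology

noncomputable section

namespace ARC

/-! ### The Rauzy graph and its matrices

The two vertices of the graph are `0`, the ordering `(1, 2, 3)` of the intervals, and `1`, the
ordering `(2, 1, 3)`. A vector of lengths `(a, b, c)` is a function on `Fin 3`. -/

def matA : Matrix (Fin 3) (Fin 3) ℝ := !![1, 1, 1; 0, 1, 0; 0, 0, 1]

def matB : Matrix (Fin 3) (Fin 3) ℝ := !![1, 0, 0; 1, 1, 1; 0, 0, 1]

def matCA : Matrix (Fin 3) (Fin 3) ℝ := !![1, 0, 0; 0, 1, 0; 1, 0, 1]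

def matCB : Matrix (Fin 3) (Fin 3) ℝ := !![1, 0, 0; 0, 1, 0; 0, 1, 1]

/-- The matrix carried by the edge from `v` to `v'` (old lengths = matrix times new lengths). -/
def edgeMatrix : Fin 2 → Fin 2 → Matrix (Fin 3) (Fin 3) ℝ
  | 0, 0 => matA
  | 0, 1 => matCA
  | 1, 0 => matCB
  | 1, 1 => matB

/-! ### The induction -/

/-- A vertex of the graph together with a vector of lengths. -/
abbrev State : Type := Fin 2 × (Fin 3 → ℝ)

/-- The lengths for which the induction follows the edge from `v` to `v'`. -/
def cell : Fin 2 → Fin 2 → Set (Fin 3 → ℝ)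
  | 0, 0 => {l | l 1 + l 2 < l 0}
  | 0, 1 => {l | l 0 < l 2}
  | 1, 0 => {l | l 1 < l 2}
  | 1, 1 => {l | l 0 + l 2 < l 1}

open Classical in
/-- One step of the (linear) induction; states in the hole are left unchanged. -/
def step (x : State) : State :=
  if x.2 ∈ cell x.1 0 then (0, (edgeMatrix x.1 0)⁻¹.mulVec x.2)
  else if x.2 ∈ cell x.1 1 then (1, (edgeMatrix x.1 1)⁻¹.mulVec x.2)
  else x

/-- The projectivized induction: after each step the lengths are rescaled to have sum `1`. -/
def induction (x : State) : State :=
  ((step x).1, (∑ i, (step x).2 i)⁻¹ • (step x).2)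

/-- The parameters of infinite type: rationally independent lengths of sum `1` whose orbit under
the induction never enters the hole. -/
def gasket : Set State :=
  {x | x.2 ∈ stdSimplex ℝ (Fin 3) ∧ LinearIndependent ℚ x.2 ∧
    ∀ n : ℕ, ∃ v : Fin 2, (induction^[n] x).2 ∈ cell (induction^[n] x).1 v}

/-! ### Kolmogorov–Sinai entropy -/

section Entropy

variable {Ω : Type*} [MeasurableSpace Ω]

/-- Shannon entropy of the finite partition of `Ω` into the level sets of `ξ`. -/
def partitionEntropy (P : Measure Ω) {ι : Type*} [Fintype ι] (ξ : Ω → ι) : ℝ :=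
  ∑ i, Real.negMulLog (P.real (ξ ⁻¹' {i}))

/-- Entropy of `F` relative to the partition `ξ`: the infimum over `n ≥ 1` (which, for an
invariant probability measure, is the limit) of `1 / n` times the entropy of
`ξ ∨ F⁻¹ ξ ∨ ⋯ ∨ F⁻⁽ⁿ⁻¹⁾ ξ`. -/
def entropyRate (P : Measure Ω) (F : Ω → Ω) {k : ℕ} (ξ : Ω → Fin k) : ℝ :=
  ⨅ n : ℕ, partitionEntropy P (fun x (i : Fin (n + 1)) => ξ (F^[(i : ℕ)] x)) / ((n : ℝ) + 1)

/-- The Kolmogorov–Sinai entropy: the supremum over all finite measurable partitions. -/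
def entropy (P : Measure Ω) (F : Ω → Ω) : ENNReal :=
  ⨆ (k : ℕ) (ξ : Ω → Fin k) (_ : Measurable ξ), ENNReal.ofReal (entropyRate P F ξ)

end Entropy

/-! ### The canonical suspension -/

/-- The roof function: minus the logarithm of the total length left by one step. -/
def roof (x : State) : ℝ := -Real.log (∑ i, (step x).2 i)

/-- The region under the graph of the roof function. -/
def underRoof : Set (State × ℝ) := {y | 0 ≤ y.2 ∧ y.2 < roof y.1}

/-- The semiflow of the canonical suspension, for times `s ≥ 0`: move up by `s` and apply the
induction each time the roof is reached. -/
def suspensionFlow (s : ℝ) (y : State × ℝ) : State × ℝ :=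
  let n : ℕ := sInf {n : ℕ | y.2 + s < birkhoffSum induction roof (n + 1) y.1}
  (induction^[n] y.1, y.2 + s - birkhoffSum induction roof n y.1)

/-- Invariant probability measures of the canonical suspension over the gasket. -/
structure IsSuspensionInvariant (P : Measure (State × ℝ)) : Prop where
  prob : IsProbabilityMeasure P
  ae_mem : ∀ᵐ y ∂P, y.1 ∈ gasket ∧ y ∈ underRoof
  invariant : ∀ s : ℝ, 0 ≤ s → MeasurePreserving (suspensionFlow s) P P

/-- Measures of maximal entropy of the canonical suspension; the entropy of a semiflow is the
entropy of its time-one map. -/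
structure IsMaximalEntropy (P : Measure (State × ℝ)) : Prop where
  invariant : IsSuspensionInvariant P
  maximal : ∀ Q : Measure (State × ℝ), IsSuspensionInvariant Q →
    entropy Q (suspensionFlow 1) ≤ entropy P (suspensionFlow 1)

/-- The natural measure: the invariant probability measure of the induction, carried by the
gasket, which induces the measure of maximal entropy on the canonical suspension. Here
`ProbabilityTheory.cond` restricts the product of `μ` and Lebesgue measure to the region under the
roof, and normalizes it. -/
structure IsNaturalMeasure (μ : Measure State) : Prop where
  prob : IsProbabilityMeasure μ
  ae_mem : ∀ᵐ x ∂μ, x ∈ gasket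
  invariant : MeasurePreserving induction μ μ
  maximal : IsMaximalEntropy (ProbabilityTheory.cond (μ.prod volume) underRoof)

/-! ### Walks and the cocycle -/

/-- The walk along the graph followed by the orbit of a state. -/
def walk (x : State) (n : ℕ) : Fin 2 := (induction^[n] x).1

theorem measurableSet_cell (v v' : Fin 2) : MeasurableSet (cell v v') := by
  fin_cases v <;> fin_cases v' <;> simp only [cell] <;>
    exact measurableSet_lt (by fun_prop) (by fun_prop)

theorem measurableSet_mem_cell (v' : Fin 2) : MeasurableSet {x : State | x.2 ∈ cell x.1 v'} := by
  have : {x : State | x.2 ∈ cell x.1 v'} = ⋃ v : Fin 2, ({v} : Set (Fin 2)) ×ˢ cell v v' := by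
    ext x; simp
  rw [this]
  exact MeasurableSet.iUnion fun v => (measurableSet_singleton v).prod (measurableSet_cell v v')

theorem measurable_apply (v' : Fin 2) :
    Measurable fun x : State => (edgeMatrix x.1 v')⁻¹.mulVec x.2 := by
  apply measurable_from_prod_countable_right
  intro v
  exact (Continuous.matrix_mulVec (A := fun _ : Fin 3 → ℝ => (edgeMatrix v v')⁻¹) continuous_const continuous_id).measurable

theorem measurable_step : Measurable step := by
  unfold step
  refine Measurable.ite (measurableSet_mem_cell 0) (measurable_const.prodMk (measurable_apply 0)) ?_
  exact Measurable.ite (measurableSet_mem_cell 1) (measurable_const.prodMk (measurable_apply 1))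
    measurable_id

theorem measurable_induction : Measurable induction := by
  have h := measurable_step
  unfold induction
  fun_prop

theorem measurable_walk : Measurable walk :=
  measurable_pi_lambda _ fun n => measurable_fst.comp (measurable_induction.iterate n)

/-- The measure induced on the set of walks. -/
def walkMeasure (μ : Measure State) : Measure (ℕ → Fin 2) := μ.map walk

/-- The product of the matrices along the first `n` edges of a walk. -/
def cocycle (w : ℕ → Fin 2) : ℕ → Matrix (Fin 3) (Fin 3) ℝ
  | 0 => 1
  | n + 1 => cocycle w n * edgeMatrix (w n) (w (n + 1))

/-- The matrix of the second exterior power, in the basis of the vectors `e j ∧ e k` with `j < k`,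
indexed by the element of `Fin 3` different from `j` and `k`. -/
def wedgeTwo (M : Matrix (Fin 3) (Fin 3) ℝ) : Matrix (Fin 3) (Fin 3) ℝ :=
  Matrix.of fun i j => (M.submatrix i.succAbove j.succAbove).det

section Lyapunov

attribute [local instance] Matrix.linftyOpNormedAddCommGroup

/-- `l₁, l₂, l₃` are the Lyapunov exponents of the cocycle along the walk `w`, with existence of
the limits included (they do not depend on the choice of the norm). -/
structure HasLyapunovExponents (w : ℕ → Fin 2) (l₁ l₂ l₃ : ℝ) : Prop where
  first : Tendsto (fun n : ℕ => Real.log ‖cocycle w n‖ / (n : ℝ)) atTop (𝓝 l₁)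
  second : Tendsto (fun n : ℕ => Real.log ‖wedgeTwo (cocycle w n)‖ / (n : ℝ)) atTop (𝓝 (l₁ + l₂))
  third : l₃ = -(l₁ + l₂)

end Lyapunov

end ARC

end

/-!
# Pisot spectrum of the ARC induction

The signs of the exponents hold for every invariant probability measure carried by the gasket;
they come from the combinatorics of the induction, and only the existence of the limits from
ergodic theory. Write `X n` for the product of the matrices along the first `n` edges, and `l n`
for the lengths after `n` steps, so that `X n` sends a multiple of `l n` to `l 0`.

*Existence.* `log ‖X n‖` and `log ‖∧² X n‖` are subadditive over the shift on walks. They are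
nonnegative since the matrices are integral and nonzero, and at most linear in `n` since there are
only four edges. Kingman's theorem for such processes is `IsSubadditiveProcess.exists_limit`: a
tiling of orbits (`IsSubadditiveProcess.le_of_tiling`) bounds the means of the process by the
integral of its lower rate. For Birkhoff sums this also bounds the upper rate, and applying that to
the iterates of the map bounds the upper rate of the process.

*The first exponent.* Since `X n` sends lengths of total `exp (- ∑ roof)` to lengths of total `1`,
its norm grows at least like the exponential of the Birkhoff sums of a positive function
(`exp_mul_le_norm_cocycle`).

*The second exponent.* Let the transposed matrices act on the covectors `f` that annihilate `l 0`.
On such a covector `0` is a weighted mean of the coordinates, and modulo `(1, 1, 1)` a loop at the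
vertex `0` replaces one coordinate by `0`: the first one for the edge `0 → 0`, the last one for an
excursion `0 → 1 → ⋯ → 1 → 0`. So the oscillation `max f - min f` never increases from one visit of
the vertex `0` to the next. With a suitable norm at the vertex `1` this becomes true edge by edge
(`gauge_vecMul_le`), and the path `0 → 0 → 1` contracts by the definite factor `1 - b`, where `b` is
the second length (`gauge_vecMul_vecMul_le`). The lengths would become negative if this path did
not occur in the walk (`exists_pattern_of_lengths`), so by recurrence
(`ae_tendsto_birkhoffSum_pos`) the covectors decay exponentially. Finally a `2 × 2` minor of `X n`
is, up to a constant, the wedge product of such a covector with a row of `X n`; hence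
`‖∧² X n‖ ≤ K exp (-ε n) ‖X n‖` and the second exponent is negative.
-/

noncomputable section

namespace ARC

/-! ### Kingman's subadditive ergodic theorem for bounded processes -/

section Kingman

variable {Ω : Type*} [MeasurableSpace Ω] {μ : Measure Ω} {T : Ω → Ω} {g : ℕ → Ω → ℝ} {C : ℝ}

/-- A measurable process `g` that is subadditive along the orbits of `T` and satisfies
`0 ≤ g n ≤ C * n` everywhere. The bounds keep all real `liminf`s and `limsup`s below meaningful. -/
structure IsSubadditiveProcess (T : Ω → Ω) (g : ℕ → Ω → ℝ) (C : ℝ) : Prop where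
  measurable : ∀ n, Measurable (g n)
  nonneg : ∀ n x, 0 ≤ g n x
  le_mul : ∀ n x, g n x ≤ C * n
  subadd : ∀ m n x, g (m + n) x ≤ g m x + g n (T^[m] x)

/-- The lower growth rate `liminf (g n x / n)`. -/
def lowerRate (g : ℕ → Ω → ℝ) (x : Ω) : ℝ := liminf (fun n : ℕ => g n x / n) atTop

/-- The upper growth rate `limsup (g n x / n)`. -/
def upperRate (g : ℕ → Ω → ℝ) (x : Ω) : ℝ := limsup (fun n : ℕ => g n x / n) atTop

theorem integral_comp_measurePreserving (hT : MeasurePreserving T μ μ) {f : Ω → ℝ}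
    (hf : AEStronglyMeasurable f μ) : ∫ x, f (T x) ∂μ = ∫ x, f x ∂μ := by
  have h := integral_map (μ := μ) (f := f) hT.measurable.aemeasurable (by rwa [hT.map_eq])
  rw [hT.map_eq] at h
  exact h.symm

/-- A function that does not decrease along orbits is invariant, as its integral is preserved. -/
theorem comp_ae_eq_of_le_comp [IsFiniteMeasure μ] (hT : MeasurePreserving T μ μ) {f : Ω → ℝ}
    (hf : Integrable f μ) (hle : ∀ x, f x ≤ f (T x)) : f ∘ T =ᵐ[μ] f := by
  have hfT : Integrable (fun x => f (T x)) μ := hT.integrable_comp_of_integrable hf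
  have hint : ∫ x, (f (T x) - f x) ∂μ = 0 := by
    rw [integral_sub hfT hf, integral_comp_measurePreserving hT hf.aestronglyMeasurable, sub_self]
  have h3 := (integral_eq_zero_iff_of_nonneg (fun x => sub_nonneg.2 (hle x))
    (hfT.sub hf)).1 hint
  filter_upwards [h3] with x hx
  simp only [Pi.zero_apply] at hx
  simp only [Function.comp_apply]
  linarith

theorem ae_forall_iterate_eq (hT : MeasurePreserving T μ μ) {f : Ω → ℝ}
    (hf : f ∘ T =ᵐ[μ] f) : ∀ᵐ x ∂μ, ∀ n : ℕ, f (T^[n] x) = f x := by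
  rw [ae_all_iff]
  intro n
  induction n with
  | zero => simp
  | succ n ih =>
    have h := (hT.iterate n).quasiMeasurePreserving.ae hf
    filter_upwards [ih, h] with x h1 h2
    rw [Function.iterate_succ_apply']
    exact h2.trans h1

theorem liminf_le_liminf_of_le_add {u v e : ℕ → ℝ} {a b : ℝ} (hu : ∀ n, a ≤ u n)
    (hv : ∀ n, v n ≤ b) (he : Tendsto e atTop (𝓝 0)) (h : ∀ n, u n ≤ v n + e n) :
    liminf u atTop ≤ liminf v atTop := by
  refine le_of_forall_pos_le_add fun ε hε => ?_
  have hub : IsBoundedUnder (· ≥ ·) atTop u := isBoundedUnder_of ⟨a, hu⟩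
  have hvb : IsBoundedUnder (· ≤ ·) atTop v := isBoundedUnder_of ⟨b, hv⟩
  have h1 := eventually_lt_of_lt_liminf
    (show liminf u atTop - ε / 2 < liminf u atTop by linarith) hub
  have h2 := he.eventually_lt_const (show (0 : ℝ) < ε / 2 by linarith)
  have h3 : liminf u atTop - ε ≤ liminf v atTop := by
    refine le_liminf_of_le hvb.isCoboundedUnder_ge ?_
    filter_upwards [h1, h2] with n h1 h2
    linarith [h n]
  linarith

namespace IsSubadditiveProcess

variable (hg : IsSubadditiveProcess T g C)
include hg

theorem const_nonneg (x : Ω) : 0 ≤ C := by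
  have h1 := hg.nonneg 1 x
  have h2 := hg.le_mul 1 x
  simp only [Nat.cast_one, mul_one] at h2
  linarith

theorem div_natCast_nonneg (n : ℕ) (x : Ω) : 0 ≤ g n x / n :=
  div_nonneg (hg.nonneg n x) n.cast_nonneg

theorem div_natCast_le (n : ℕ) (x : Ω) : g n x / n ≤ C :=
  div_le_of_le_mul₀ n.cast_nonneg (hg.const_nonneg x) (hg.le_mul n x)

theorem isBoundedUnder_le (x : Ω) : IsBoundedUnder (· ≤ ·) atTop fun n : ℕ => g n x / n :=
  isBoundedUnder_of ⟨C, fun n => hg.div_natCast_le n x⟩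

theorem isBoundedUnder_ge (x : Ω) : IsBoundedUnder (· ≥ ·) atTop fun n : ℕ => g n x / n :=
  isBoundedUnder_of ⟨0, fun n => hg.div_natCast_nonneg n x⟩

theorem measurable_lowerRate : Measurable (lowerRate g) :=
  Measurable.liminf fun n => (hg.measurable n).div_const _

theorem measurable_upperRate : Measurable (upperRate g) :=
  Measurable.limsup fun n => (hg.measurable n).div_const _

theorem lowerRate_nonneg (x : Ω) : 0 ≤ lowerRate g x :=
  le_liminf_of_le (hg.isBoundedUnder_le x).isCoboundedUnder_ge
    (Eventually.of_forall fun n => hg.div_natCast_nonneg n x)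

theorem lowerRate_le_upperRate (x : Ω) : lowerRate g x ≤ upperRate g x :=
  liminf_le_limsup (hg.isBoundedUnder_le x) (hg.isBoundedUnder_ge x)

theorem upperRate_le (x : Ω) : upperRate g x ≤ C :=
  limsup_le_of_le (hg.isBoundedUnder_ge x).isCoboundedUnder_le
    (Eventually.of_forall fun n => hg.div_natCast_le n x)

theorem integrable_lowerRate [IsFiniteMeasure μ] : Integrable (lowerRate g) μ :=
  Integrable.of_bound hg.measurable_lowerRate.aestronglyMeasurable C
    (Eventually.of_forall fun x => by
      rw [Real.norm_of_nonneg (hg.lowerRate_nonneg x)]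
      exact (hg.lowerRate_le_upperRate x).trans (hg.upperRate_le x))

theorem integrable_upperRate [IsFiniteMeasure μ] : Integrable (upperRate g) μ :=
  Integrable.of_bound hg.measurable_upperRate.aestronglyMeasurable C
    (Eventually.of_forall fun x => by
      rw [Real.norm_of_nonneg ((hg.lowerRate_nonneg x).trans (hg.lowerRate_le_upperRate x))]
      exact hg.upperRate_le x)

theorem integrable [IsFiniteMeasure μ] (n : ℕ) : Integrable (g n) μ :=
  Integrable.of_bound (hg.measurable n).aestronglyMeasurable (C * n)
    (Eventually.of_forall fun x => by
      rw [Real.norm_of_nonneg (hg.nonneg n x)]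
      exact hg.le_mul n x)

theorem lowerRate_le_comp (x : Ω) : lowerRate g x ≤ lowerRate g (T x) := by
  have hC := hg.const_nonneg x
  unfold lowerRate
  rw [← liminf_nat_add (fun n : ℕ => g n x / n) 1]
  refine liminf_le_liminf_of_le_add (a := 0) (b := C) (e := fun n : ℕ => C / ((n : ℝ) + 1))
    (fun n => hg.div_natCast_nonneg _ x) (fun n => hg.div_natCast_le n (T x))
    ?_ fun n => ?_
  · simpa [Function.comp_def] using
      (tendsto_const_div_atTop_nhds_zero_nat C).comp (tendsto_add_atTop_nat 1)
  have h1 := hg.subadd 1 n x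
  have h2 := hg.le_mul 1 x
  simp only [Nat.cast_one, mul_one, Function.iterate_one] at h1 h2
  rw [add_comm 1 n] at h1
  have h3 : g n (T x) / ((n : ℝ) + 1) ≤ g n (T x) / n := by
    rcases Nat.eq_zero_or_pos n with rfl | hn
    · have := hg.le_mul 0 (T x)
      simp only [Nat.cast_zero, mul_zero] at this
      simp [le_antisymm this (hg.nonneg 0 _)]
    · exact div_le_div_of_nonneg_left (hg.nonneg _ _) (by exact_mod_cast hn) (by linarith)
  push_cast
  calc g (n + 1) x / ((n : ℝ) + 1) ≤ (C + g n (T x)) / ((n : ℝ) + 1) := by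
        gcongr; linarith
    _ = g n (T x) / ((n : ℝ) + 1) + C / ((n : ℝ) + 1) := by ring
    _ ≤ _ := by linarith

theorem lowerRate_comp_ae_eq [IsFiniteMeasure μ] (hT : MeasurePreserving T μ μ) :
    lowerRate g ∘ T =ᵐ[μ] lowerRate g :=
  comp_ae_eq_of_le_comp hT hg.integrable_lowerRate hg.lowerRate_le_comp

/-- The orbit segment of length `n` is tiled by blocks of length at most `M` on which the process
is at most `ε` above its lower rate, and by single points of the set `B` where no such block
starts. -/
theorem le_of_tiling {ε : ℝ} (hε : 0 < ε) {M : ℕ} (hM : 1 ≤ M) {B : Set Ω}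
    (hB : ∀ x ∉ B, ∃ k, 1 ≤ k ∧ k ≤ M ∧ g k x ≤ k * (lowerRate g x + ε)) (n : ℕ) :
    ∀ x, (∀ i, lowerRate g (T^[i] x) = lowerRate g x) →
      g n x ≤ n * (lowerRate g x + ε) +
        C * ∑ i ∈ Finset.range n, B.indicator (fun _ => (1 : ℝ)) (T^[i] x) + C * M := by
  induction n using Nat.strong_induction_on with
  | _ n ih =>
    intro x hx
    have hC := hg.const_nonneg x
    have hl := hg.lowerRate_nonneg x
    have hind : ∀ y, 0 ≤ B.indicator (fun _ => (1 : ℝ)) y :=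
      fun y => Set.indicator_nonneg (fun _ _ => zero_le_one) y
    -- a remainder shorter than a block costs at most `C * M`
    by_cases hn : n < M
    · have h1 := hg.le_mul n x
      have h2 : C * n ≤ C * M := by gcongr
      have h3 : 0 ≤ ∑ i ∈ Finset.range n, B.indicator (fun _ => (1 : ℝ)) (T^[i] x) :=
        Finset.sum_nonneg fun i _ => hind _
      have : 0 ≤ n * (lowerRate g x + ε) := by positivity
      have := mul_nonneg hC h3
      linarith
    push Not at hn
    have key : ∃ k, 1 ≤ k ∧ k ≤ n ∧ g k x ≤ k * (lowerRate g x + ε) +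
        C * ∑ i ∈ Finset.range k, B.indicator (fun _ => (1 : ℝ)) (T^[i] x) := by
      by_cases hxB : x ∈ B
      · refine ⟨1, le_rfl, hM.trans hn, ?_⟩
        have h1 := hg.le_mul 1 x
        simp [hxB] at h1 ⊢
        linarith
      · obtain ⟨k, hk1, hkM, hk⟩ := hB x hxB
        refine ⟨k, hk1, hkM.trans hn, hk.trans ?_⟩
        have h3 : 0 ≤ ∑ i ∈ Finset.range k, B.indicator (fun _ => (1 : ℝ)) (T^[i] x) :=
          Finset.sum_nonneg fun i _ => hind _
        have := mul_nonneg hC h3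
        linarith
    obtain ⟨k, hk1, hkn, hk⟩ := key
    obtain ⟨m, rfl⟩ := Nat.exists_eq_add_of_le hkn
    have h1 := ih m (by omega) (T^[k] x) fun i => by
      rw [← Function.iterate_add_apply, hx, hx]
    have h2 := hg.subadd k m x
    rw [hx k] at h1
    rw [Finset.sum_range_add]
    have h3 : ∀ i, T^[k + i] x = T^[i] (T^[k] x) := fun i => by
      rw [add_comm, Function.iterate_add_apply]
    simp only [h3]
    push_cast
    linarith

/-- Half of Kingman's theorem: the normalized means of the process come arbitrarily close to the
integral of the lower rate. -/
theorem exists_integral_le [IsProbabilityMeasure μ] (hT : MeasurePreserving T μ μ) {ε : ℝ}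
    (hε : 0 < ε) : ∃ n : ℕ, 1 ≤ n ∧ ∫ x, g n x ∂μ ≤ n * (∫ x, lowerRate g x ∂μ + ε) := by
  obtain ⟨x₀⟩ : Nonempty Ω := nonempty_of_isProbabilityMeasure μ
  have hC := hg.const_nonneg x₀
  have hε3 : 0 < ε / 3 := by positivity
  -- `B M`: no block of length at most `M` starts at the point
  set B : ℕ → Set Ω := fun M => {x | ∀ k, 1 ≤ k → k ≤ M → k * (lowerRate g x + ε / 3) < g k x}
    with hBdef
  have hBm : ∀ M, MeasurableSet (B M) := fun M => by
    have : B M = ⋂ k : ℕ, ⋂ _ : 1 ≤ k, ⋂ _ : k ≤ M,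
        {x | k * (lowerRate g x + ε / 3) < g k x} := by
      ext x; simp [hBdef]
    rw [this]
    refine MeasurableSet.iInter fun k => MeasurableSet.iInter fun _ => MeasurableSet.iInter fun _ =>
      measurableSet_lt ((hg.measurable_lowerRate.add_const _).const_mul _) (hg.measurable k)
  have hBanti : Antitone B := fun M N hMN x hx k hk hkM => hx k hk (hkM.trans hMN)
  have hBempty : ⋂ M, B M = ∅ := by
    rw [Set.eq_empty_iff_forall_notMem]
    intro x hx
    have hfr := frequently_lt_of_liminf_lt (hg.isBoundedUnder_le x).isCoboundedUnder_ge
      (show lowerRate g x < lowerRate g x + ε / 3 by linarith)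
    obtain ⟨k, hk, hk1⟩ := (hfr.and_eventually (eventually_ge_atTop 1)).exists
    have hkpos : (0 : ℝ) < k := by exact_mod_cast hk1
    rw [div_lt_iff₀ hkpos] at hk
    have := Set.mem_iInter.1 hx k k hk1 le_rfl
    linarith
  have hlim : Tendsto (fun M => C * μ.real (B M)) atTop (𝓝 0) := by
    have h1 := tendsto_measure_iInter_atTop (μ := μ) (fun M => (hBm M).nullMeasurableSet) hBanti
      ⟨0, measure_ne_top _ _⟩
    rw [hBempty, measure_empty] at h1
    have h2 := (ENNReal.tendsto_toReal ENNReal.zero_ne_top).comp h1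
    simpa [Measure.real, Function.comp_def] using h2.const_mul C
  obtain ⟨M, hM, hM1⟩ := ((hlim.eventually_lt_const hε3).and (eventually_ge_atTop 1)).exists
  obtain ⟨n, hn⟩ := exists_nat_gt (C * M / (ε / 3))
  have hCM : C * M < n * (ε / 3) := by rwa [div_lt_iff₀ hε3] at hn
  have hn1 : 1 ≤ n := by
    rcases Nat.eq_zero_or_pos n with rfl | h
    · have : 0 ≤ C * M := by positivity
      simp at hCM
      linarith
    · exact h
  refine ⟨n, hn1, ?_⟩
  have hpt : ∀ᵐ x ∂μ, g n x ≤ n * (lowerRate g x + ε / 3) +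
      C * ∑ i ∈ Finset.range n, (B M).indicator (fun _ => (1 : ℝ)) (T^[i] x) + C * M := by
    filter_upwards [ae_forall_iterate_eq hT (hg.lowerRate_comp_ae_eq hT)] with x hx
    refine hg.le_of_tiling hε3 hM1 (fun y hy => ?_) n x hx
    simpa [hBdef] using hy
  have hind : Integrable ((B M).indicator (fun _ => (1 : ℝ))) μ :=
    (integrable_const 1).indicator (hBm M)
  have hindT : ∀ i, Integrable (fun x => (B M).indicator (fun _ => (1 : ℝ)) (T^[i] x)) μ :=
    fun i => (hT.iterate i).integrable_comp_of_integrable hind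
  have hindint : ∀ i, ∫ x, (B M).indicator (fun _ => (1 : ℝ)) (T^[i] x) ∂μ = μ.real (B M) :=
    fun i => by
    rw [integral_comp_measurePreserving (hT.iterate i) hind.aestronglyMeasurable,
      integral_indicator_const _ (hBm M)]
    simp
  have hl := hg.integrable_lowerRate (μ := μ)
  have hI1 : Integrable (fun x => n * (lowerRate g x + ε / 3)) μ :=
    (hl.add (integrable_const _)).const_mul _
  have hI2 : Integrable (fun x => C * ∑ i ∈ Finset.range n,
      (B M).indicator (fun _ => (1 : ℝ)) (T^[i] x)) μ :=
    (integrable_finsetSum _ fun i _ => hindT i).const_mul _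
  calc ∫ x, g n x ∂μ ≤ ∫ x, (n * (lowerRate g x + ε / 3) +
      C * ∑ i ∈ Finset.range n, (B M).indicator (fun _ => (1 : ℝ)) (T^[i] x) + C * M) ∂μ :=
        integral_mono_ae (hg.integrable n) ((hI1.add hI2).add (integrable_const _)) hpt
    _ = n * (∫ x, lowerRate g x ∂μ + ε / 3) + C * (n * μ.real (B M)) + C * M := by
        have hI3 := hI1.add hI2
        simp only [Pi.add_def] at hI3
        rw [integral_add hI3 (integrable_const _), integral_add hI1 hI2,
          integral_const_mul, integral_const_mul, integral_add hl (integrable_const _),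
          integral_finsetSum _ fun i _ => hindT i]
        simp [hindint]
    _ ≤ n * (∫ x, lowerRate g x ∂μ + ε) := by
        have : C * (n * μ.real (B M)) ≤ n * (ε / 3) := by
          rw [mul_left_comm]
          gcongr
        linarith

end IsSubadditiveProcess

section Birkhoff

variable {φ : Ω → ℝ}

theorem isSubadditiveProcess_birkhoffSum (hT : Measurable T) (hφ : Measurable φ)
    (h0 : ∀ x, 0 ≤ φ x) (h1 : ∀ x, φ x ≤ C) :
    IsSubadditiveProcess T (fun n => birkhoffSum T φ n) C where
  measurable n := by
    unfold birkhoffSum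
    exact Finset.measurable_fun_sum _ fun i _ => hφ.comp (hT.iterate i)
  nonneg n x := Finset.sum_nonneg fun i _ => h0 _
  le_mul n x := by
    refine (Finset.sum_le_sum fun i _ => h1 (T^[i] x)).trans ?_
    simp [mul_comm]
  subadd m n x := (birkhoffSum_add T φ m n x).le

theorem integral_birkhoffSum [IsFiniteMeasure μ] (hT : MeasurePreserving T μ μ)
    (hφ : Integrable φ μ) (n : ℕ) : ∫ x, birkhoffSum T φ n x ∂μ = n * ∫ x, φ x ∂μ := by
  have hi : ∀ i, Integrable (fun x => φ (T^[i] x)) μ :=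
    fun i => (hT.iterate i).integrable_comp_of_integrable hφ
  have : ∀ i, ∫ x, φ (T^[i] x) ∂μ = ∫ x, φ x ∂μ :=
    fun i => integral_comp_measurePreserving (hT.iterate i) hφ.aestronglyMeasurable
  unfold birkhoffSum
  rw [integral_finsetSum _ fun i _ => hi i]
  simp [this]

/-- The case of a bounded function `φ` over the map `T`: apply `exists_integral_le` to `C - φ`,
whose Birkhoff sums are additive and whose lower rate is `C` minus the upper rate of `φ`. -/
theorem integral_upperRate_birkhoffSum_le [IsProbabilityMeasure μ] (hT : MeasurePreserving T μ μ)
    (hφ : Measurable φ) (h0 : ∀ x, 0 ≤ φ x) (h1 : ∀ x, φ x ≤ C) :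
    ∫ x, upperRate (fun n => birkhoffSum T φ n) x ∂μ ≤ ∫ x, φ x ∂μ := by
  have hg := isSubadditiveProcess_birkhoffSum hT.measurable hφ h0 h1
  have hg' := isSubadditiveProcess_birkhoffSum (φ := fun x => C - φ x) hT.measurable
    (hφ.const_sub C) (fun x => sub_nonneg.2 (h1 x)) (fun x => sub_le_self C (h0 x))
  have hφi : Integrable φ μ := by simpa using hg.integrable (μ := μ) 1
  have hlow : ∀ x, lowerRate (fun n => birkhoffSum T (fun x => C - φ x) n) x =
      C - upperRate (fun n => birkhoffSum T φ n) x := fun x => by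
    unfold lowerRate upperRate
    rw [← liminf_const_sub _ _ _ (hg.isBoundedUnder_le x)
      (hg.isBoundedUnder_ge x).isCoboundedUnder_le]
    refine liminf_congr ?_
    filter_upwards [eventually_ge_atTop 1] with n hn
    have hn0 : (n : ℝ) ≠ 0 := by positivity
    simp only [birkhoffSum, Finset.sum_sub_distrib, Finset.sum_const, Finset.card_range,
      nsmul_eq_mul]
    field_simp
  refine le_of_forall_pos_le_add fun ε hε => ?_
  obtain ⟨n, hn1, hn⟩ := hg'.exists_integral_le hT hε
  have hφi' : Integrable (fun x => C - φ x) μ := (integrable_const C).sub hφi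
  rw [integral_birkhoffSum hT hφi'] at hn
  have hn0 : (0 : ℝ) < n := by exact_mod_cast hn1
  have h2 := le_of_mul_le_mul_left hn hn0
  simp only [hlow] at h2
  rw [integral_sub (integrable_const _) hφi,
    integral_sub (integrable_const _) hg.integrable_upperRate] at h2
  linarith

end Birkhoff

namespace IsSubadditiveProcess

variable (hg : IsSubadditiveProcess T g C)
include hg

theorem apply_mul_le_birkhoffSum (m k : ℕ) (x : Ω) : g (m * k) x ≤ birkhoffSum T^[m] (g m) k x := by
  induction k with
  | zero => simpa using hg.le_mul 0 x
  | succ k ih =>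
    have h := hg.subadd (m * k) m x
    rw [birkhoffSum_succ, ← Function.iterate_mul, Nat.mul_succ]
    linarith

/-- The upper rate of a process is at most that of the Birkhoff averages of `g m` over `T^[m]`,
divided by `m`. -/
theorem upperRate_le_birkhoffSum {m : ℕ} (hm : 1 ≤ m) (x : Ω) :
    upperRate g x ≤ (m : ℝ)⁻¹ * upperRate (fun k => birkhoffSum T^[m] (g m) k) x := by
  have hC := hg.const_nonneg x
  have hm0 : (0 : ℝ) < m := by exact_mod_cast hm
  have hA : ∀ k : ℕ, birkhoffSum T^[m] (g m) k x / k ≤ C * m := fun k => by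
    refine div_le_of_le_mul₀ k.cast_nonneg (by positivity) ?_
    refine (Finset.sum_le_sum fun i _ => hg.le_mul m _).trans ?_
    simp [mul_comm]
  have hA0 : ∀ k : ℕ, 0 ≤ birkhoffSum T^[m] (g m) k x :=
    fun k => Finset.sum_nonneg fun i _ => hg.nonneg _ _
  have hbdd : IsBoundedUnder (· ≤ ·) atTop fun k : ℕ => birkhoffSum T^[m] (g m) k x / k :=
    isBoundedUnder_of ⟨_, hA⟩
  refine le_of_forall_pos_le_add fun ε hε => ?_
  set U := upperRate (fun k => birkhoffSum T^[m] (g m) k) x with hU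
  have h1 : ∀ᶠ k : ℕ in atTop, birkhoffSum T^[m] (g m) k x / k < U + m * (ε / 2) :=
    eventually_lt_of_limsup_lt (show _ < U + m * (ε / 2) by
      have : 0 < m * (ε / 2) := by positivity
      simp only [hU, upperRate] at this ⊢
      linarith) hbdd
  have h2 := (Nat.tendsto_div_const_atTop (by omega : m ≠ 0)).eventually h1
  have h3 := (tendsto_const_div_atTop_nhds_zero_nat (C * m)).eventually_lt_const
    (show (0 : ℝ) < ε / 2 by positivity)
  refine limsup_le_of_le (hg.isBoundedUnder_ge x).isCoboundedUnder_le ?_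
  filter_upwards [h2, h3, eventually_ge_atTop m] with n h2 h3 hn
  -- cut `[0, n)` into `k` blocks of length `m` and a remainder of length `n % m`
  set k := n / m with hk
  have hk1 : 1 ≤ k := (Nat.one_le_div_iff (by omega)).2 hn
  have hk0 : (0 : ℝ) < k := by exact_mod_cast hk1
  have hn0 : (0 : ℝ) < n := by
    have : 0 < n := by omega
    exact_mod_cast this
  have hnk : m * k + n % m = n := Nat.div_add_mod n m
  have hkn : (m : ℝ) * k ≤ n := by exact_mod_cast Nat.mul_div_le n m
  have h4 : g n x ≤ birkhoffSum T^[m] (g m) k x + C * m := by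
    have h5 := hg.subadd (m * k) (n % m) x
    rw [hnk] at h5
    have h6 := hg.le_mul (n % m) (T^[m * k] x)
    have h7 : C * ((n % m : ℕ) : ℝ) ≤ C * m := by
      gcongr
      exact (Nat.mod_lt _ (by omega)).le
    linarith [hg.apply_mul_le_birkhoffSum m k x]
  have h8 : birkhoffSum T^[m] (g m) k x / n ≤ (m : ℝ)⁻¹ * (birkhoffSum T^[m] (g m) k x / k) := by
    rw [← div_eq_inv_mul, div_div, mul_comm (k : ℝ)]
    exact div_le_div_of_nonneg_left (hA0 k) (by positivity) hkn
  have h9 : (m : ℝ)⁻¹ * (birkhoffSum T^[m] (g m) k x / k) ≤ (m : ℝ)⁻¹ * (U + m * (ε / 2)) := by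
    gcongr
  have h10 : (m : ℝ)⁻¹ * (U + m * (ε / 2)) = (m : ℝ)⁻¹ * U + ε / 2 := by
    field_simp
  calc g n x / n ≤ (birkhoffSum T^[m] (g m) k x + C * m) / n := by gcongr
    _ = birkhoffSum T^[m] (g m) k x / n + C * m / n := add_div _ _ _
    _ ≤ _ := by linarith

theorem upperRate_ae_eq_lowerRate [IsProbabilityMeasure μ] (hT : MeasurePreserving T μ μ) :
    upperRate g =ᵐ[μ] lowerRate g := by
  have hle : ∫ x, upperRate g x ∂μ ≤ ∫ x, lowerRate g x ∂μ := by
    refine le_of_forall_pos_le_add fun ε hε => ?_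
    obtain ⟨m, hm, h⟩ := hg.exists_integral_le hT hε
    have hm0 : (0 : ℝ) < m := by exact_mod_cast hm
    have hb := isSubadditiveProcess_birkhoffSum (hT.iterate m).measurable (hg.measurable m)
      (hg.nonneg m) (hg.le_mul m)
    calc ∫ x, upperRate g x ∂μ
        ≤ ∫ x, (m : ℝ)⁻¹ * upperRate (fun k => birkhoffSum T^[m] (g m) k) x ∂μ :=
          integral_mono hg.integrable_upperRate (hb.integrable_upperRate.const_mul _)
            (hg.upperRate_le_birkhoffSum hm)
      _ = (m : ℝ)⁻¹ * ∫ x, upperRate (fun k => birkhoffSum T^[m] (g m) k) x ∂μ :=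
          integral_const_mul _ _
      _ ≤ (m : ℝ)⁻¹ * ∫ x, g m x ∂μ := by
          refine mul_le_mul_of_nonneg_left ?_ (by positivity)
          exact integral_upperRate_birkhoffSum_le (hT.iterate m) (hg.measurable m) (hg.nonneg m)
            (hg.le_mul m)
      _ ≤ (m : ℝ)⁻¹ * (m * (∫ x, lowerRate g x ∂μ + ε)) := by gcongr
      _ = _ := by field_simp
  have h0 : ∫ x, (upperRate g x - lowerRate g x) ∂μ = 0 := by
    refine le_antisymm ?_ (integral_nonneg fun x => sub_nonneg.2 (hg.lowerRate_le_upperRate x))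
    rw [integral_sub hg.integrable_upperRate hg.integrable_lowerRate]
    linarith
  have h1 := (integral_eq_zero_iff_of_nonneg
    (fun x => sub_nonneg.2 (hg.lowerRate_le_upperRate x))
    (hg.integrable_upperRate.sub hg.integrable_lowerRate)).1 h0
  filter_upwards [h1] with x hx
  simp only [Pi.zero_apply] at hx
  linarith

theorem ae_tendsto [IsProbabilityMeasure μ] (hT : MeasurePreserving T μ μ) :
    ∀ᵐ x ∂μ, Tendsto (fun n : ℕ => g n x / n) atTop (𝓝 (lowerRate g x)) := by
  filter_upwards [hg.upperRate_ae_eq_lowerRate hT] with x hx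
  exact tendsto_of_liminf_eq_limsup rfl hx (hg.isBoundedUnder_le x) (hg.isBoundedUnder_ge x)

/-- Kingman's theorem for bounded processes. -/
theorem exists_limit [IsProbabilityMeasure μ] (hT : MeasurePreserving T μ μ) :
    ∃ L : Ω → ℝ, Measurable L ∧ L ∘ T =ᵐ[μ] L ∧
      ∀ᵐ x ∂μ, Tendsto (fun n : ℕ => g n x / n) atTop (𝓝 (L x)) :=
  ⟨lowerRate g, hg.measurable_lowerRate, hg.lowerRate_comp_ae_eq hT, hg.ae_tendsto hT⟩

end IsSubadditiveProcess

/-- If almost every orbit meets the set where a bounded `φ ≥ 0` is positive, it does so with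
positive frequency. On the invariant set `Z` where the rate vanishes, the integral of `φ` is zero,
so no orbit in `Z` meets that set. -/
theorem ae_lowerRate_birkhoffSum_pos [IsProbabilityMeasure μ] (hT : MeasurePreserving T μ μ)
    {φ : Ω → ℝ} (hφ : Measurable φ) (h0 : ∀ x, 0 ≤ φ x) (h1 : ∀ x, φ x ≤ C)
    (hpos : ∀ᵐ x ∂μ, ∃ n : ℕ, 0 < φ (T^[n] x)) :
    ∀ᵐ x ∂μ, 0 < lowerRate (fun n => birkhoffSum T φ n) x := by
  have hg := isSubadditiveProcess_birkhoffSum hT.measurable hφ h0 h1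
  set L := lowerRate (fun n => birkhoffSum T φ n) with hL
  have hLm : Measurable L := hg.measurable_lowerRate
  set Z : Set Ω := {x | L x ≤ 0} with hZ
  have hZm : MeasurableSet Z := measurableSet_le hLm measurable_const
  set ψ : Ω → ℝ := Z.indicator φ with hψ
  have hψm : Measurable ψ := hφ.indicator hZm
  have hψ0 : ∀ x, 0 ≤ ψ x := fun x => Set.indicator_nonneg (fun x _ => h0 x) x
  have hψφ : ∀ x, ψ x ≤ φ x := fun x => Set.indicator_le_self' (fun x _ => h0 x) x
  have hψ1 : ∀ x, ψ x ≤ C := fun x => (hψφ x).trans (h1 x)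
  have hg' := isSubadditiveProcess_birkhoffSum hT.measurable hψm hψ0 hψ1
  have hψi : Integrable ψ μ := by simpa using hg'.integrable (μ := μ) 1
  have hLinv := ae_forall_iterate_eq hT (hg.lowerRate_comp_ae_eq hT)
  have hrate : ∀ᵐ x ∂μ, lowerRate (fun n => birkhoffSum T ψ n) x ≤ 0 := by
    filter_upwards [hLinv] with x hx
    by_cases hxZ : x ∈ Z
    · refine le_trans ?_ hxZ
      exact liminf_le_liminf_of_le_add (a := 0) (b := C) (e := fun _ => 0)
        (fun n => hg'.div_natCast_nonneg n x) (fun n => hg.div_natCast_le n x)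
        tendsto_const_nhds fun n => by
          rw [add_zero]
          exact div_le_div_of_nonneg_right (Finset.sum_le_sum fun i _ => hψφ _) n.cast_nonneg
    · have : ∀ i, ψ (T^[i] x) = 0 := fun i => by
        refine Set.indicator_of_notMem (fun h => hxZ ?_) _
        simp only [hZ, Set.mem_ofPred_eq] at h ⊢
        have h3 : L (T^[i] x) = L x := hx i
        linarith
      simp [lowerRate, birkhoffSum, this]
  have hint : ∫ x, ψ x ∂μ ≤ 0 := by
    refine le_of_forall_pos_le_add fun ε hε => ?_
    obtain ⟨n, hn1, hn⟩ := hg'.exists_integral_le hT hε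
    rw [integral_birkhoffSum hT hψi] at hn
    have hn0 : (0 : ℝ) < n := by exact_mod_cast hn1
    have h2 := le_of_mul_le_mul_left hn hn0
    have h3 : ∫ x, lowerRate (fun n => birkhoffSum T ψ n) x ∂μ ≤ 0 := integral_nonpos_of_ae hrate
    linarith
  have hzero := (integral_eq_zero_iff_of_nonneg hψ0 hψi).1 (le_antisymm hint (integral_nonneg hψ0))
  have hzeroT : ∀ᵐ x ∂μ, ∀ n : ℕ, ψ (T^[n] x) = 0 :=
    ae_all_iff.2 fun n => (hT.iterate n).quasiMeasurePreserving.ae hzero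
  filter_upwards [hpos, hzeroT, hLinv] with x ⟨n, hn⟩ hz hx
  by_contra hneg
  have hmem : T^[n] x ∈ Z := by
    simp only [hZ, Set.mem_ofPred_eq]
    have h3 : L (T^[n] x) = L x := hx n
    linarith
  have := hz n
  rw [hψ, Set.indicator_of_mem hmem] at this
  linarith

theorem ae_tendsto_birkhoffSum_pos [IsProbabilityMeasure μ] (hT : MeasurePreserving T μ μ)
    {φ : Ω → ℝ} (hφ : Measurable φ) (h0 : ∀ x, 0 ≤ φ x) (h1 : ∀ x, φ x ≤ C)
    (hpos : ∀ᵐ x ∂μ, ∃ n : ℕ, 0 < φ (T^[n] x)) :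
    ∀ᵐ x ∂μ, ∃ r, 0 < r ∧ Tendsto (fun n : ℕ => birkhoffSum T φ n x / n) atTop (𝓝 r) := by
  filter_upwards [ae_lowerRate_birkhoffSum_pos hT hφ h0 h1 hpos,
    (isSubadditiveProcess_birkhoffSum hT.measurable hφ h0 h1).ae_tendsto hT] with x hx hlim
  exact ⟨_, hx, hlim⟩

end Kingman

/-! ### The cocycle as a bounded subadditive process over the shift -/

section Cocycle

theorem det_edgeMatrix (v v' : Fin 2) : (edgeMatrix v v').det = 1 := by
  fin_cases v <;> fin_cases v' <;>
    simp [edgeMatrix, matA, matB, matCA, matCB, Matrix.det_fin_three]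

/-- The left shift on walks. -/
def shift (w : ℕ → Fin 2) (n : ℕ) : Fin 2 := w (n + 1)

theorem shift_iterate (m : ℕ) (w : ℕ → Fin 2) (n : ℕ) : shift^[m] w n = w (n + m) := by
  induction m generalizing w with
  | zero => rfl
  | succ m ih => rw [Function.iterate_succ_apply, ih, shift, add_assoc]

theorem measurable_shift : Measurable shift :=
  measurable_pi_lambda _ fun n => measurable_pi_apply (n + 1)

theorem cocycle_add (w : ℕ → Fin 2) (m n : ℕ) :
    cocycle w (m + n) = cocycle w m * cocycle (shift^[m] w) n := by
  induction n with
  | zero => simp [cocycle]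
  | succ n ih =>
    rw [← add_assoc, cocycle, ih, cocycle, Matrix.mul_assoc, shift_iterate, shift_iterate,
      add_comm n m, add_right_comm n 1 m, add_comm n m]

theorem det_cocycle (w : ℕ → Fin 2) (n : ℕ) : (cocycle w n).det = 1 := by
  induction n with
  | zero => simp [cocycle]
  | succ n ih => rw [cocycle, Matrix.det_mul, ih, det_edgeMatrix, one_mul]

theorem cocycle_congr {w w' : ℕ → Fin 2} {n : ℕ} (h : ∀ k ≤ n, w k = w' k) :
    cocycle w n = cocycle w' n := by
  induction n with
  | zero => rfl
  | succ n ih =>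
    rw [cocycle, cocycle, ih fun k hk => h k (by omega), h n (by omega), h (n + 1) le_rfl]

/-- `cocycle w n` only depends on the first `n + 1` vertices of the walk, so that any function of it
is measurable, whatever the measurable structure on matrices. -/
theorem measurable_cocycle (F : Matrix (Fin 3) (Fin 3) ℝ → ℝ) (n : ℕ) :
    Measurable fun w => F (cocycle w n) := by
  have h : (fun w => F (cocycle w n)) =
      (fun u : Fin (n + 1) → Fin 2 =>
        F (cocycle (fun k => if h : k < n + 1 then u ⟨k, h⟩ else 0) n)) ∘
      fun w i => w i := by
    funext w
    refine congrArg F (cocycle_congr fun k hk => ?_)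
    simp [Nat.lt_succ_of_le hk]
  rw [h]
  exact (measurable_of_finite _).comp (measurable_pi_lambda _ fun i => measurable_pi_apply _)

theorem wedgeTwo_apply (M : Matrix (Fin 3) (Fin 3) ℝ) (i j : Fin 3) :
    wedgeTwo M i j = M (i.succAbove 0) (j.succAbove 0) * M (i.succAbove 1) (j.succAbove 1) -
      M (i.succAbove 0) (j.succAbove 1) * M (i.succAbove 1) (j.succAbove 0) := by
  simp [wedgeTwo, Matrix.det_fin_two]

/-- The Cauchy–Binet formula for `2 × 2` minors. -/
theorem wedgeTwo_mul (M N : Matrix (Fin 3) (Fin 3) ℝ) :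
    wedgeTwo (M * N) = wedgeTwo M * wedgeTwo N := by
  have h0 : (0 : Fin 3).succAbove (0 : Fin 2) = 1 ∧
      (0 : Fin 3).succAbove (1 : Fin 2) = 2 := by decide
  have h1 : (1 : Fin 3).succAbove (0 : Fin 2) = 0 ∧
      (1 : Fin 3).succAbove (1 : Fin 2) = 2 := by decide
  have h2 : (2 : Fin 3).succAbove (0 : Fin 2) = 0 ∧
      (2 : Fin 3).succAbove (1 : Fin 2) = 1 := by decide
  ext i j
  simp only [wedgeTwo_apply, Matrix.mul_apply, Fin.sum_univ_three, h0, h1, h2]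
  ring

theorem wedgeTwo_one : wedgeTwo 1 = 1 := by
  ext i j
  fin_cases i <;> fin_cases j <;> simp [wedgeTwo_apply, Fin.succAbove, Fin.lt_def]

/-- The entries of `wedgeTwo M` are those of the adjugate up to sign and transposition. -/
theorem wedgeTwo_ne_zero {M : Matrix (Fin 3) (Fin 3) ℝ} (h : M.det ≠ 0) : wedgeTwo M ≠ 0 := by
  intro h0
  have hadj : M.adjugate = 0 := by
    ext i j
    have := congrFun (congrFun h0 j) i
    simp only [wedgeTwo, Matrix.of_apply, Matrix.zero_apply] at this
    rw [Matrix.adjugate_fin_succ_eq_det_submatrix, this, mul_zero, Matrix.zero_apply]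
  have h1 := M.mul_adjugate
  rw [hadj, Matrix.mul_zero] at h1
  have h2 := congrFun (congrFun h1 0) 0
  simp at h2
  exact h h2.symm

theorem exists_int_edgeMatrix (v v' : Fin 2) :
    ∃ N : Matrix (Fin 3) (Fin 3) ℤ, edgeMatrix v v' = N.map (Int.cast : ℤ → ℝ) := by
  -- the integer matrix with the same entries
  refine ⟨(edgeMatrix v v').map Int.floor, ?_⟩
  ext i j
  fin_cases v <;> fin_cases v' <;> fin_cases i <;> fin_cases j <;>
    simp [edgeMatrix, matA, matB, matCA, matCB]

theorem exists_int_cocycle (w : ℕ → Fin 2) (n : ℕ) :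
    ∃ N : Matrix (Fin 3) (Fin 3) ℤ, cocycle w n = N.map (Int.cast : ℤ → ℝ) := by
  induction n with
  | zero => exact ⟨1, by simp [cocycle]⟩
  | succ n ih =>
    obtain ⟨N, hN⟩ := ih
    obtain ⟨N', hN'⟩ := exists_int_edgeMatrix (w n) (w (n + 1))
    refine ⟨N * N', ?_⟩
    rw [cocycle, hN, hN']
    exact (Matrix.map_mul (f := Int.castRingHom ℝ)).symm

theorem exists_int_wedgeTwo {M : Matrix (Fin 3) (Fin 3) ℝ}
    (h : ∃ N : Matrix (Fin 3) (Fin 3) ℤ, M = N.map (Int.cast : ℤ → ℝ)) :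
    ∃ N : Matrix (Fin 3) (Fin 3) ℤ, wedgeTwo M = N.map (Int.cast : ℤ → ℝ) := by
  obtain ⟨N, rfl⟩ := h
  refine ⟨Matrix.of fun i j => (N.submatrix i.succAbove j.succAbove).det, ?_⟩
  ext i j
  simp [wedgeTwo, Matrix.det_fin_two]

attribute [local instance] Matrix.linftyOpNormedAddCommGroup

theorem abs_apply_le_norm (M : Matrix (Fin 3) (Fin 3) ℝ) (i j : Fin 3) : |M i j| ≤ ‖M‖ := by
  rw [Matrix.linfty_opNorm_def]
  have h1 : ‖M i j‖₊ ≤ ∑ j, ‖M i j‖₊ :=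
    Finset.single_le_sum (f := fun j => ‖M i j‖₊) (fun _ _ => zero_le) (Finset.mem_univ j)
  have h2 := h1.trans (Finset.le_sup (f := fun i => ∑ j, ‖M i j‖₊) (Finset.mem_univ i))
  exact_mod_cast h2

theorem norm_le_of_abs_apply_le {M : Matrix (Fin 3) (Fin 3) ℝ} {r : ℝ}
    (h : ∀ i j, |M i j| ≤ r) : ‖M‖ ≤ 3 * r := by
  have hr : 0 ≤ r := (abs_nonneg _).trans (h 0 0)
  lift r to NNReal using hr
  rw [Matrix.linfty_opNorm_def]
  have : (Finset.univ.sup fun i => ∑ j, ‖M i j‖₊) ≤ 3 * r := by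
    refine Finset.sup_le fun i _ => ?_
    calc ∑ j, ‖M i j‖₊ ≤ ∑ _j : Fin 3, r := Finset.sum_le_sum fun j _ => by
          have := h i j
          exact_mod_cast this
      _ = 3 * r := by simp
  exact_mod_cast this

theorem one_le_norm_of_int {M : Matrix (Fin 3) (Fin 3) ℝ}
    (h : ∃ N : Matrix (Fin 3) (Fin 3) ℤ, M = N.map (Int.cast : ℤ → ℝ)) (h0 : M ≠ 0) :
    1 ≤ ‖M‖ := by
  obtain ⟨N, rfl⟩ := h
  have : ∃ i j, N i j ≠ 0 := by
    by_contra! hN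
    exact h0 (by ext i j; simp [hN])
  obtain ⟨i, j, hij⟩ := this
  refine le_trans ?_ (abs_apply_le_norm _ i j)
  rw [Matrix.map_apply]
  exact_mod_cast Int.one_le_abs hij

theorem one_le_norm_cocycle (w : ℕ → Fin 2) (n : ℕ) : 1 ≤ ‖cocycle w n‖ := by
  refine one_le_norm_of_int (exists_int_cocycle w n) fun h => ?_
  have := det_cocycle w n
  rw [h] at this
  simp [Matrix.det_zero] at this

theorem one_le_norm_wedgeTwo_cocycle (w : ℕ → Fin 2) (n : ℕ) : 1 ≤ ‖wedgeTwo (cocycle w n)‖ :=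
  one_le_norm_of_int (exists_int_wedgeTwo (exists_int_cocycle w n))
    (wedgeTwo_ne_zero (by simp [det_cocycle]))

/-- Stated for a multiplicative `F` in order to cover both the cocycle (`F = id`) and its second
exterior power (`F = wedgeTwo`). -/
theorem exists_isSubadditiveProcess {F : Matrix (Fin 3) (Fin 3) ℝ → Matrix (Fin 3) (Fin 3) ℝ}
    (hmul : ∀ M N, F (M * N) = F M * F N) (hone : F 1 = 1)
    (hnorm : ∀ w n, 1 ≤ ‖F (cocycle w n)‖) :
    ∃ C, IsSubadditiveProcess shift (fun n w => Real.log ‖F (cocycle w n)‖) C := by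
  set K : ℝ := ∑ v, ∑ v', ‖F (edgeMatrix v v')‖ with hK
  have hedge : ∀ v v', ‖F (edgeMatrix v v')‖ ≤ K := fun v v' =>
    (Finset.single_le_sum (f := fun v' => ‖F (edgeMatrix v v')‖) (fun _ _ => norm_nonneg _)
      (Finset.mem_univ v')).trans
    (Finset.single_le_sum (f := fun v => ∑ v', ‖F (edgeMatrix v v')‖)
      (fun _ _ => Finset.sum_nonneg fun _ _ => norm_nonneg _) (Finset.mem_univ v))
  have hpos : ∀ w n, 0 < ‖F (cocycle w n)‖ := fun w n => zero_lt_one.trans_le (hnorm w n)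
  have hK0 : 0 < K := by
    refine lt_of_lt_of_le (hpos 0 1) ?_
    simpa [cocycle] using hedge 0 0
  have hstep : ∀ w n, Real.log ‖F (cocycle w (n + 1))‖ ≤ Real.log ‖F (cocycle w n)‖ + Real.log K :=
    fun w n => by
    rw [← Real.log_mul (hpos w n).ne' hK0.ne']
    refine Real.log_le_log (hpos w _) ?_
    rw [cocycle, hmul]
    exact (Matrix.linfty_opNorm_mul _ _).trans
      (mul_le_mul_of_nonneg_left (hedge _ _) (norm_nonneg _))
  refine ⟨Real.log K, fun n => measurable_cocycle (fun M => Real.log ‖F M‖) n,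
    fun n w => Real.log_nonneg (hnorm w n), fun n w => ?_, fun m n w => ?_⟩
  · induction n with
    | zero =>
      have h1 : ‖(1 : Matrix (Fin 3) (Fin 3) ℝ)‖ = 1 := by
        rw [← Matrix.diagonal_one, Matrix.linfty_opNorm_diagonal]
        simp
      simp [cocycle, hone, h1]
    | succ n ih =>
      have := hstep w n
      push_cast
      linarith
  · rw [← Real.log_mul (hpos _ _).ne' (hpos _ _).ne', cocycle_add, hmul]
    refine Real.log_le_log ?_ (Matrix.linfty_opNorm_mul _ _)
    rw [← hmul, ← cocycle_add]
    exact hpos _ _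

end Cocycle

/-! ### A polygonal norm on the annihilator of the lengths -/

section Gauge

/-- Two seminorms on covectors `f`, one for each vertex, that are norms on the annihilator of a
positive vector. At the vertex `0` it is the oscillation `max f - min f`; at the vertex `1` it is
the pullback of the oscillation under the edge `1 → 0`, which is preserved by the loop `1 → 1`. -/
def gauge : Fin 2 → (Fin 3 → ℝ) → ℝ
  | 0, f => max |f 0 - f 1| (max |f 0 - f 2| |f 1 - f 2|)
  | 1, f => max |f 0 - f 2| (max |f 1| |f 0 - f 2 - f 1|)

theorem gauge_nonneg (v : Fin 2) (f : Fin 3 → ℝ) : 0 ≤ gauge v f := by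
  fin_cases v <;> exact (abs_nonneg _).trans (le_max_left _ _)

/-- As `f` annihilates a positive vector, `0` lies between the extreme coordinates of `f`. -/
theorem abs_le_gauge_zero {f l : Fin 3 → ℝ} (hl : ∀ i, 0 < l i) (hf : f ⬝ᵥ l = 0) (i : Fin 3) :
    |f i| ≤ gauge 0 f := by
  have h01 : |f 0 - f 1| ≤ gauge 0 f := le_max_left _ _
  have h02 : |f 0 - f 2| ≤ gauge 0 f := (le_max_left _ _).trans (le_max_right _ _)
  have h12 : |f 1 - f 2| ≤ gauge 0 f := (le_max_right _ _).trans (le_max_right _ _)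
  set O := gauge 0 f
  rw [abs_le] at h01 h02 h12
  have h0 := hl 0
  have h1 := hl 1
  have h2 := hl 2
  simp only [dotProduct, Fin.sum_univ_three] at hf
  by_contra! hlt
  rcases lt_abs.1 hlt with h | h <;> fin_cases i <;>
    simp only [Fin.zero_eta, Fin.mk_one, Fin.reduceFinMk] at h
  all_goals
    have hO : 0 ≤ O := by linarith
    nlinarith

theorem vecMul_matA (f : Fin 3 → ℝ) : Matrix.vecMul f matA = ![f 0, f 0 + f 1, f 0 + f 2] := by
  ext i
  fin_cases i <;> simp [Matrix.vecMul, dotProduct, Fin.sum_univ_three, matA]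

theorem vecMul_matB (f : Fin 3 → ℝ) : Matrix.vecMul f matB = ![f 0 + f 1, f 1, f 1 + f 2] := by
  ext i
  fin_cases i <;> simp [Matrix.vecMul, dotProduct, Fin.sum_univ_three, matB]

theorem vecMul_matCA (f : Fin 3 → ℝ) : Matrix.vecMul f matCA = ![f 0 + f 2, f 1, f 2] := by
  ext i
  fin_cases i <;> simp [Matrix.vecMul, dotProduct, Fin.sum_univ_three, matCA]

theorem vecMul_matCB (f : Fin 3 → ℝ) : Matrix.vecMul f matCB = ![f 0, f 1 + f 2, f 2] := by
  ext i
  fin_cases i <;> simp [Matrix.vecMul, dotProduct, Fin.sum_univ_three, matCB]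

theorem gauge_vecMul_le {f l : Fin 3 → ℝ} (hl : ∀ i, 0 < l i) (hf : f ⬝ᵥ l = 0) (v v' : Fin 2) :
    gauge v' (Matrix.vecMul f (edgeMatrix v v')) ≤ gauge v f := by
  have h01 : |f 0 - f 1| ≤ gauge 0 f := le_max_left _ _
  have h12 : |f 1 - f 2| ≤ gauge 0 f := (le_max_right _ _).trans (le_max_right _ _)
  have h0 := abs_le_gauge_zero hl hf 0
  have h1 := abs_le_gauge_zero hl hf 1
  have h2 := abs_le_gauge_zero hl hf 2
  have k0 : |f 0 - f 2| ≤ gauge 1 f := le_max_left _ _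
  have k1 : |f 1| ≤ gauge 1 f := (le_max_left _ _).trans (le_max_right _ _)
  have k2 : |f 0 - f 2 - f 1| ≤ gauge 1 f := (le_max_right _ _).trans (le_max_right _ _)
  fin_cases v <;> fin_cases v'
  · change gauge 0 (Matrix.vecMul f matA) ≤ gauge 0 f
    rw [vecMul_matA]
    refine max_le ?_ (max_le ?_ ?_)
    · simpa using h1
    · simpa using h2
    · simpa using h12
  · change gauge 1 (Matrix.vecMul f matCA) ≤ gauge 0 f
    rw [vecMul_matCA]
    refine max_le ?_ (max_le ?_ ?_)
    · simpa using h0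
    · simpa using h1
    · simpa using h01
  · change gauge 0 (Matrix.vecMul f matCB) ≤ gauge 1 f
    rw [vecMul_matCB]
    refine max_le ?_ (max_le ?_ ?_)
    · refine le_trans (le_of_eq ?_) k2
      simp only [Matrix.cons_val]
      ring_nf
    · simpa using k0
    · simpa using k1
  · change gauge 1 (Matrix.vecMul f matB) ≤ gauge 1 f
    rw [vecMul_matB]
    refine max_le ?_ (max_le ?_ ?_)
    · refine le_trans (le_of_eq ?_) k0
      simp only [Matrix.cons_val]
      ring_nf
    · simpa using k1
    · refine le_trans (le_of_eq ?_) k2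
      simp only [Matrix.cons_val]
      ring_nf

/-- The definite contraction along `0 → 0 → 1`: the two steps leave the differences of the vector
`(f 0, f 0 + f 1, 0)`, and `f 0 + f 1` is a combination of the differences of `f` with coefficients
`1 - 2 * l 1` and `2 * l 2 < 1 - 2 * l 1`. -/
theorem gauge_vecMul_vecMul_le {f l : Fin 3 → ℝ} (hl : ∀ i, 0 < l i) (hsum : ∑ i, l i = 1)
    (hf : f ⬝ᵥ l = 0) (hcell : l 1 + l 2 < l 0) :
    gauge 1 (Matrix.vecMul (Matrix.vecMul f (edgeMatrix 0 0)) (edgeMatrix 0 1)) ≤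
      (1 - l 1) * gauge 0 f := by
  have h01 : |f 0 - f 1| ≤ gauge 0 f := le_max_left _ _
  have h02 : |f 0 - f 2| ≤ gauge 0 f := (le_max_left _ _).trans (le_max_right _ _)
  have h12 : |f 1 - f 2| ≤ gauge 0 f := (le_max_right _ _).trans (le_max_right _ _)
  set O := gauge 0 f
  rw [abs_le] at h01 h02 h12
  obtain ⟨h01, h01'⟩ := h01
  obtain ⟨h02, h02'⟩ := h02
  obtain ⟨h12, h12'⟩ := h12
  have h0 := hl 0
  have h1 := hl 1
  have h2 := hl 2
  simp only [dotProduct, Fin.sum_univ_three] at hf hsum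
  have ha : l 0 = 1 - l 1 - l 2 := by linarith
  have hO : 0 ≤ O := gauge_nonneg 0 f
  change gauge 1 (Matrix.vecMul (Matrix.vecMul f matA) matCA) ≤ _
  rw [vecMul_matA, vecMul_matCA]
  have e0 : f 0 = l 1 * (f 0 - f 1) + l 2 * (f 0 - f 2) := by rw [ha] at hf; linarith
  have e1 : f 1 = l 0 * (f 1 - f 0) + l 2 * (f 1 - f 2) := by rw [ha] at hf ⊢; linarith
  have e2 : f 0 + f 1 = (1 - 2 * l 1) * (f 1 - f 0) + 2 * l 2 * (f 0 - f 2) := by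
    rw [ha] at hf; linarith
  refine max_le ?_ (max_le ?_ ?_) <;> simp only [Matrix.cons_val]
  · rw [add_sub_cancel_right, abs_le]
    constructor <;> nlinarith
  · rw [e2, abs_le]
    constructor <;> rcases le_total (f 1) (f 0) with h | h <;>
      rcases le_total (f 0) (f 2) with h' | h' <;>
      nlinarith
  · rw [show f 0 + (f 0 + f 2) - (f 0 + f 2) - (f 0 + f 1) = - f 1 by ring, abs_neg, abs_le]
    constructor <;> nlinarith
end Gauge

/-! ### Orbits of infinite type -/

section Orbits

theorem edgeMatrix_mulVec (v v' : Fin 2) (m : Fin 3 → ℝ) :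
    (edgeMatrix v v').mulVec m = match v, v' with
      | 0, 0 => ![m 0 + m 1 + m 2, m 1, m 2]
      | 0, 1 => ![m 0, m 1, m 0 + m 2]
      | 1, 0 => ![m 0, m 1, m 1 + m 2]
      | 1, 1 => ![m 0, m 0 + m 1 + m 2, m 2] := by
  ext i
  fin_cases v <;> fin_cases v' <;> fin_cases i <;>
    simp [Matrix.mulVec, dotProduct, Fin.sum_univ_three, edgeMatrix, matA, matB, matCA, matCB]

theorem pos_of_mulVec_mem_cell {v v' : Fin 2} {m : Fin 3 → ℝ}
    (hpos : ∀ i, 0 < (edgeMatrix v v').mulVec m i)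
    (hcell : (edgeMatrix v v').mulVec m ∈ cell v v') : ∀ i, 0 < m i := by
  have h0 := hpos 0
  have h1 := hpos 1
  have h2 := hpos 2
  rw [edgeMatrix_mulVec] at h0 h1 h2 hcell
  have h3 : 0 < m 0 ∧ 0 < m 1 ∧ 0 < m 2 := by
    fin_cases v <;> fin_cases v' <;>
      simp [cell] at h0 h1 h2 hcell <;> refine ⟨?_, ?_, ?_⟩ <;> linarith
  intro i
  fin_cases i
  exacts [h3.1, h3.2.1, h3.2.2]

theorem step_spec {x : State} (h : ∃ v, x.2 ∈ cell x.1 v) :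
    (edgeMatrix x.1 (step x).1).mulVec (step x).2 = x.2 ∧ x.2 ∈ cell x.1 (step x).1 := by
  have hinv : ∀ v, (edgeMatrix x.1 v).mulVec ((edgeMatrix x.1 v)⁻¹.mulVec x.2) = x.2 := fun v => by
    rw [Matrix.mulVec_mulVec, Matrix.mul_nonsing_inv _ (by simp [det_edgeMatrix]),
      Matrix.one_mulVec]
  unfold step
  split_ifs with h0 h1
  · exact ⟨hinv 0, h0⟩
  · exact ⟨hinv 1, h1⟩
  · obtain ⟨v, hv⟩ := h
    fin_cases v
    exacts [absurd hv h0, absurd hv h1]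

/-- States with positive lengths of total `1` whose orbit never enters the hole. Positivity is all
that is needed of rational independence. -/
structure IsInfiniteType (x : State) : Prop where
  pos : ∀ i, 0 < x.2 i
  sum : ∑ i, x.2 i = 1
  mem_cell : ∀ n : ℕ, ∃ v : Fin 2, (induction^[n] x).2 ∈ cell (induction^[n] x).1 v

theorem isInfiniteType_of_mem_gasket {x : State} (hx : x ∈ gasket) : IsInfiniteType x := by
  obtain ⟨⟨h0, h1⟩, h2, h3⟩ := hx
  exact ⟨fun i => (h0 i).lt_of_ne (h2.ne_zero i).symm, h1, h3⟩

namespace IsInfiniteType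

variable {x : State} (hx : IsInfiniteType x)
include hx

theorem step_pos (i : Fin 3) : 0 < (step x).2 i := by
  obtain ⟨h1, h2⟩ := step_spec (x := x) (hx.mem_cell 0)
  exact pos_of_mulVec_mem_cell (v := x.1) (v' := (step x).1) (by rw [h1]; exact hx.pos)
    (by rw [h1]; exact h2) i

theorem sum_step_pos : 0 < ∑ i, (step x).2 i :=
  Finset.sum_pos (fun i _ => hx.step_pos i) Finset.univ_nonempty

theorem sum_step_lt_one : ∑ i, (step x).2 i < 1 := by
  have h1 := (step_spec (x := x) (hx.mem_cell 0)).1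
  have h2 := hx.sum
  have p0 := hx.step_pos 0
  have p1 := hx.step_pos 1
  have p2 := hx.step_pos 2
  rw [← h1, edgeMatrix_mulVec] at h2
  generalize (step x).2 = m at *
  generalize (step x).1 = v' at *
  generalize x.1 = v at *
  fin_cases v <;> fin_cases v' <;> simp [Fin.sum_univ_three] at h2 ⊢ <;> linarith

theorem edgeMatrix_mulVec_induction :
    (∑ i, (step x).2 i) • (edgeMatrix x.1 (induction x).1).mulVec (induction x).2 = x.2 := by
  have h1 := (step_spec (x := x) (hx.mem_cell 0)).1
  rw [induction, Matrix.mulVec_smul, smul_smul, mul_inv_cancel₀ hx.sum_step_pos.ne', one_smul, h1]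

theorem mem_cell_induction : x.2 ∈ cell x.1 (induction x).1 := (step_spec (hx.mem_cell 0)).2

theorem induction : IsInfiniteType (induction x) where
  pos i := mul_pos (inv_pos.2 hx.sum_step_pos) (hx.step_pos i)
  sum := by
    change ∑ i, (∑ i, (step x).2 i)⁻¹ * (step x).2 i = 1
    rw [← Finset.mul_sum, inv_mul_cancel₀ hx.sum_step_pos.ne']
  mem_cell n := by
    have := hx.mem_cell (n + 1)
    rwa [Function.iterate_succ_apply] at this

theorem iterate (n : ℕ) : IsInfiniteType (ARC.induction^[n] x) := by
  induction n with
  | zero => exact hx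
  | succ n ih => rw [Function.iterate_succ_apply']; exact ih.induction

end IsInfiniteType

/-- The factor by which the first `n` steps of the linear induction shrink the total length. -/
def lengthProd (x : State) (n : ℕ) : ℝ :=
  ∏ k ∈ Finset.range n, ∑ i, (step (induction^[k] x)).2 i

theorem lengthProd_pos {x : State} (hx : IsInfiniteType x) (n : ℕ) : 0 < lengthProd x n :=
  Finset.prod_pos fun k _ => (hx.iterate k).sum_step_pos

theorem lengthProd_smul {x : State} (hx : IsInfiniteType x) (n : ℕ) :
    (edgeMatrix (walk x n) (walk x (n + 1))).mulVec
      (lengthProd x (n + 1) • (induction^[n + 1] x).2) = lengthProd x n • (induction^[n] x).2 := by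
  rw [← (hx.iterate n).edgeMatrix_mulVec_induction, Matrix.mulVec_smul, smul_smul, lengthProd,
    Finset.prod_range_succ, ← lengthProd, walk, walk, Function.iterate_succ_apply']

theorem cocycle_mulVec {x : State} (hx : IsInfiniteType x) (n : ℕ) :
    (cocycle (walk x) n).mulVec (lengthProd x n • (induction^[n] x).2) = x.2 := by
  induction n with
  | zero => simp [cocycle, lengthProd]
  | succ n ih => rw [cocycle, ← Matrix.mulVec_mulVec, lengthProd_smul hx, ih]

theorem not_forall_add_le_sub {s : ℕ → ℝ} (hs : ∀ n, 0 < s n) {δ : ℝ} (hδ : 0 < δ) (m k : ℕ) :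
    ¬ ∀ n, m ≤ n → s (n + k) ≤ s n - δ := by
  intro h
  have h1 : ∀ j : ℕ, s (m + k * j) ≤ s m - j * δ := fun j => by
    induction j with
    | zero => simp
    | succ j ih =>
      have := h (m + k * j) (by omega)
      rw [Nat.mul_succ, ← add_assoc]
      push_cast
      linarith
  obtain ⟨j, hj⟩ := exists_nat_gt (s m / δ)
  rw [div_lt_iff₀ hδ] at hj
  linarith [h1 j, hs (m + k * j)]

/-- The lengths along an infinite orbit force the path `0 → 0 → 1`: otherwise the walk either stays
at the vertex `0` from some time on, or never uses the loop `0 → 0`. In both cases a constant length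
is subtracted from the total infinitely often. -/
theorem exists_pattern_of_lengths {w : ℕ → Fin 2} {l : ℕ → Fin 3 → ℝ} (hpos : ∀ n i, 0 < l n i)
    (h : ∀ n, (edgeMatrix (w n) (w (n + 1))).mulVec (l (n + 1)) = l n) :
    ∃ n, w n = 0 ∧ w (n + 1) = 0 ∧ w (n + 2) = 1 := by
  by_contra! hno
  have hno' : ∀ n, w n = 0 → w (n + 1) = 0 → w (n + 2) = 0 := fun n h0 h1 => by
    have := hno n h0 h1
    omega
  have hsum : ∀ n, 0 < ∑ i, l n i := fun n =>
    Finset.sum_pos (fun i _ => hpos n i) Finset.univ_nonempty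
  -- how the lengths change along each of the four edges
  have hedge : ∀ n, (w n = 0 → w (n + 1) = 0 → l (n + 1) 1 = l n 1 ∧
        ∑ i, l (n + 1) i ≤ ∑ i, l n i - l n 1) ∧
      (w n = 0 → w (n + 1) = 1 → l (n + 1) 0 = l n 0 ∧
        ∑ i, l (n + 1) i ≤ ∑ i, l n i - l n 0) ∧
      (w n = 1 → w (n + 1) = 1 → l (n + 1) 0 = l n 0 ∧
        ∑ i, l (n + 1) i ≤ ∑ i, l n i - l n 0) ∧
      (w n = 1 → w (n + 1) = 0 → l (n + 1) 0 = l n 0 ∧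
        ∑ i, l (n + 1) i ≤ ∑ i, l n i) := fun n => by
    have h0 := hpos (n + 1) 0
    have h1 := hpos (n + 1) 1
    have h2 := hpos (n + 1) 2
    have hn := h n
    refine ⟨fun e e' => ?_, fun e e' => ?_, fun e e' => ?_, fun e e' => ?_⟩ <;>
      rw [e, e', edgeMatrix_mulVec] at hn <;> rw [← hn] <;>
      simp [Fin.sum_univ_three] <;> linarith
  by_cases hc : ∃ m, w m = 0 ∧ w (m + 1) = 0
  · -- the walk stays at the vertex `0`, and every step subtracts the constant second length
    obtain ⟨m, hm⟩ := hc
    have hw : ∀ n, w (m + n) = 0 ∧ w (m + n + 1) = 0 := fun n => by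
      induction n with
      | zero => exact hm
      | succ n ih => exact ⟨ih.2, hno' _ ih.1 ih.2⟩
    have hb : ∀ n, l (m + n) 1 = l m 1 := fun n => by
      induction n with
      | zero => rfl
      | succ n ih => rw [← add_assoc, ((hedge (m + n)).1 (hw n).1 (hw n).2).1, ih]
    refine not_forall_add_le_sub hsum (hpos m 1) m 1 fun n hn => ?_
    obtain ⟨k, rfl⟩ := Nat.exists_eq_add_of_le hn
    have := ((hedge (m + k)).1 (hw k).1 (hw k).2).2
    rwa [hb k] at this
  · -- the first length is constant, and of two consecutive steps at least one subtracts it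
    push Not at hc
    have hstep : ∀ n, l (n + 1) 0 = l n 0 ∧ ∑ i, l (n + 1) i ≤ ∑ i, l n i ∧
        (w (n + 1) = 1 → ∑ i, l (n + 1) i ≤ ∑ i, l n i - l n 0) := fun n => by
      obtain ⟨-, e1, e2, e3⟩ := hedge n
      have hp := hpos n 0
      rcases Fin.exists_fin_two.1 ⟨w n, rfl⟩ with h0 | h0 <;>
        rcases Fin.exists_fin_two.1 ⟨w (n + 1), rfl⟩ with h1 | h1
      · exact absurd h1 (hc n h0)
      · obtain ⟨ha, hs⟩ := e1 h0 h1
        exact ⟨ha, by linarith, fun _ => hs⟩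
      · obtain ⟨ha, hs⟩ := e3 h0 h1
        exact ⟨ha, hs, fun h => absurd (h1.symm.trans h) (by decide)⟩
      · obtain ⟨ha, hs⟩ := e2 h0 h1
        exact ⟨ha, by linarith, fun _ => hs⟩
    have ha : ∀ n, l n 0 = l 0 0 := fun n => by
      induction n with
      | zero => rfl
      | succ n ih => rw [(hstep n).1, ih]
    have hdrop : ∀ n, ∑ i, l (n + 1) i ≤ ∑ i, l n i ∧
        (w (n + 1) = 1 → ∑ i, l (n + 1) i ≤ ∑ i, l n i - l 0 0) := fun n => by
      have h := (hstep n).2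
      rwa [ha n] at h
    refine not_forall_add_le_sub hsum (hpos 0 0) 0 2 fun n _ => ?_
    have h1 := hdrop n
    have h2 := hdrop (n + 1)
    by_cases hw : w (n + 1) = 1
    · linarith [h1.2 hw, h2.1]
    · have h3 := hc (n + 1) (by omega)
      linarith [h1.1, h2.2 (by show w (n + 1 + 1) = 1; omega)]

theorem IsInfiniteType.exists_pattern {x : State} (hx : IsInfiniteType x) :
    ∃ n, walk x n = 0 ∧ walk x (n + 1) = 0 ∧ walk x (n + 2) = 1 :=
  exists_pattern_of_lengths (l := fun n => lengthProd x n • (ARC.induction^[n] x).2)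
    (fun n i => mul_pos (lengthProd_pos hx n) ((hx.iterate n).pos i)) (lengthProd_smul hx)

theorem walk_iterate (x : State) (m n : ℕ) : walk (induction^[m] x) n = walk x (n + m) := by
  rw [walk, walk, Function.iterate_add_apply]

theorem IsInfiniteType.frequently_walk_eq_zero {x : State} (hx : IsInfiniteType x) :
    ∃ᶠ n in atTop, walk x n = 0 := by
  rw [frequently_atTop]
  intro m
  obtain ⟨n, hn, -⟩ := (hx.iterate m).exists_pattern
  exact ⟨n + m, by omega, by rwa [walk_iterate] at hn⟩

end Orbits

/-! ### Growth along an orbit of infinite type -/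

section Exponents

/-- The proportion of the total length removed by one step, truncated to `[0, 1]` so as to be
bounded on all states. -/
def shrinking (x : State) : ℝ := max 0 (min 1 (1 - ∑ i, (step x).2 i))

open Classical in
/-- The second length at the states from which the walk follows `0 → 0 → 1`, and `0` elsewhere,
truncated to `[0, 1]`. It measures the contraction of `gauge` in the next two steps. -/
def contraction (x : State) : ℝ :=
  if x.1 = 0 ∧ (induction x).1 = 0 ∧ (induction (induction x)).1 = 1 then
    max 0 (min 1 (x.2 1)) else 0

theorem shrinking_nonneg (x : State) : 0 ≤ shrinking x := le_max_left _ _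

theorem shrinking_le_one (x : State) : shrinking x ≤ 1 :=
  max_le zero_le_one (min_le_left _ _)

theorem contraction_nonneg (x : State) : 0 ≤ contraction x := by
  unfold contraction
  split_ifs
  exacts [le_max_left _ _, le_rfl]

theorem contraction_le_one (x : State) : contraction x ≤ 1 := by
  unfold contraction
  split_ifs
  exacts [max_le zero_le_one (min_le_left _ _), zero_le_one]

theorem measurable_shrinking : Measurable shrinking := by
  have h := measurable_step
  unfold shrinking
  fun_prop

theorem measurable_contraction : Measurable contraction := by
  have h := measurable_induction
  refine Measurable.ite ?_ (by fun_prop) measurable_const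
  have h0 : MeasurableSet {x : State | x.1 = 0} := measurable_fst (measurableSet_singleton 0)
  have h1 : MeasurableSet {x : State | (induction x).1 = 0} :=
    (measurable_fst.comp h) (measurableSet_singleton 0)
  have h2 : MeasurableSet {x : State | (induction (induction x)).1 = 1} :=
    (measurable_fst.comp (h.comp h)) (measurableSet_singleton 1)
  exact h0.inter (h1.inter h2)

variable {x : State} (hx : IsInfiniteType x)
include hx

theorem IsInfiniteType.apply_lt_one (i : Fin 3) : x.2 i < 1 := by
  have h := hx.sum
  have h0 := hx.pos 0
  have h1 := hx.pos 1
  have h2 := hx.pos 2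
  rw [Fin.sum_univ_three] at h
  fin_cases i <;> simp <;> linarith

theorem shrinking_eq : shrinking x = 1 - ∑ i, (step x).2 i := by
  have h1 := hx.sum_step_pos
  have h2 := hx.sum_step_lt_one
  rw [shrinking, min_eq_right (by linarith), max_eq_right (by linarith)]

theorem shrinking_pos : 0 < shrinking x := by
  rw [shrinking_eq hx]
  linarith [hx.sum_step_lt_one]

theorem exists_contraction_pos : ∃ n, 0 < contraction (induction^[n] x) := by
  obtain ⟨n, h0, h1, h2⟩ := hx.exists_pattern
  refine ⟨n, ?_⟩
  rw [walk, Function.iterate_succ_apply'] at h1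
  rw [walk, Function.iterate_succ_apply', Function.iterate_succ_apply'] at h2
  rw [contraction, if_pos ⟨h0, h1, h2⟩]
  exact lt_max_of_lt_right (lt_min zero_lt_one ((hx.iterate n).pos 1))

theorem lengthProd_le_exp (n : ℕ) :
    lengthProd x n ≤ Real.exp (-birkhoffSum induction shrinking n x) := by
  rw [birkhoffSum, ← Finset.sum_neg_distrib, Real.exp_sum, lengthProd]
  refine Finset.prod_le_prod (fun k _ => (hx.iterate k).sum_step_pos.le) fun k _ => ?_
  have h := Real.add_one_le_exp (-shrinking (induction^[k] x))
  rw [shrinking_eq (hx.iterate k)] at h ⊢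
  linarith

/-- The transposed cocycle maps annihilators of the lengths to each other. -/
theorem dotProduct_vecMul_cocycle {f : Fin 3 → ℝ} (hf : f ⬝ᵥ x.2 = 0) (n : ℕ) :
    Matrix.vecMul f (cocycle (walk x) n) ⬝ᵥ (induction^[n] x).2 = 0 := by
  rw [← cocycle_mulVec hx n, Matrix.dotProduct_mulVec, dotProduct_smul, smul_eq_mul] at hf
  exact (mul_eq_zero.1 hf).resolve_left (lengthProd_pos hx n).ne'

theorem gauge_walk_succ_le {f : Fin 3 → ℝ} (hf : f ⬝ᵥ x.2 = 0) (n : ℕ) :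
    gauge (walk x (n + 1)) (Matrix.vecMul f (cocycle (walk x) (n + 1))) ≤
      gauge (walk x n) (Matrix.vecMul f (cocycle (walk x) n)) := by
  rw [cocycle, ← Matrix.vecMul_vecMul]
  exact gauge_vecMul_le (hx.iterate n).pos (dotProduct_vecMul_cocycle hx hf n) _ _

theorem gauge_walk_add_two_le {f : Fin 3 → ℝ} (hf : f ⬝ᵥ x.2 = 0) (n : ℕ) :
    gauge (walk x (n + 2)) (Matrix.vecMul f (cocycle (walk x) (n + 2))) ≤
      Real.exp (-contraction (induction^[n] x)) *
        gauge (walk x n) (Matrix.vecMul f (cocycle (walk x) n)) := by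
  have hmono : gauge (walk x (n + 2)) (Matrix.vecMul f (cocycle (walk x) (n + 2))) ≤
      gauge (walk x n) (Matrix.vecMul f (cocycle (walk x) n)) :=
    (gauge_walk_succ_le hx hf (n + 1)).trans (gauge_walk_succ_le hx hf n)
  have hy := hx.iterate n
  by_cases h : (induction^[n] x).1 = 0 ∧ (induction (induction^[n] x)).1 = 0 ∧
      (induction (induction (induction^[n] x))).1 = 1
  · have hc : contraction (induction^[n] x) = (induction^[n] x).2 1 := by
      rw [contraction, if_pos h, min_eq_right (hy.apply_lt_one 1).le, max_eq_right (hy.pos 1).le]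
    have hcell := hy.mem_cell_induction
    rw [h.1, h.2.1] at hcell
    have h0 : walk x n = 0 := h.1
    have h1 : walk x (n + 1) = 0 := by
      rw [walk, Function.iterate_succ_apply']; exact h.2.1
    have h2 : walk x (n + 2) = 1 := by
      rw [walk, Function.iterate_succ_apply', Function.iterate_succ_apply']; exact h.2.2
    have hle := gauge_vecMul_vecMul_le hy.pos hy.sum (dotProduct_vecMul_cocycle hx hf n) hcell
    have hexp := Real.add_one_le_exp (-contraction (induction^[n] x))
    rw [cocycle, cocycle, ← Matrix.vecMul_vecMul, ← Matrix.vecMul_vecMul]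
    change gauge (walk x (n + 2)) (Matrix.vecMul (Matrix.vecMul (Matrix.vecMul f _)
      (edgeMatrix (walk x n) (walk x (n + 1)))) (edgeMatrix (walk x (n + 1)) (walk x (n + 2)))) ≤ _
    rw [h2, h1, h0]
    refine hle.trans (mul_le_mul_of_nonneg_right ?_ (gauge_nonneg _ _))
    rw [← hc]
    linarith
  · rw [contraction, if_neg h, neg_zero, Real.exp_zero, one_mul]
    exact hmono

/-- The exponent is halved because each contraction takes two steps: the inequality is obtained for
the product of the gauges at two consecutive times, where every factor is used exactly once. -/
theorem gauge_walk_succ_le_exp {f : Fin 3 → ℝ} (hf : f ⬝ᵥ x.2 = 0) (n : ℕ) :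
    gauge (walk x (n + 1)) (Matrix.vecMul f (cocycle (walk x) (n + 1))) ≤
      Real.exp (-birkhoffSum induction contraction n x / 2) * gauge (walk x 0) f := by
  set N : ℕ → ℝ := fun n => gauge (walk x n) (Matrix.vecMul f (cocycle (walk x) n)) with hN
  have hN0 : ∀ n, 0 ≤ N n := fun n => gauge_nonneg _ _
  have hN1 : ∀ n, N (n + 1) ≤ N n := gauge_walk_succ_le hx hf
  have hz : N 0 = gauge (walk x 0) f := by simp [hN, cocycle]
  have hprod : ∀ n, N (n + 1) * N n ≤ Real.exp (-birkhoffSum induction contraction n x) * N 0 ^ 2 :=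
      fun n => by
    induction n with
    | zero =>
      rw [birkhoffSum_zero, neg_zero, Real.exp_zero, one_mul, sq]
      exact mul_le_mul_of_nonneg_right (hN1 0) (hN0 0)
    | succ n ih =>
      rw [birkhoffSum_succ, neg_add, Real.exp_add]
      have h2 : N (n + 2) ≤ _ * N n := gauge_walk_add_two_le hx hf n
      calc N (n + 2) * N (n + 1)
          ≤ (Real.exp (-contraction (induction^[n] x)) * N n) * N (n + 1) :=
            mul_le_mul_of_nonneg_right h2 (hN0 _)
        _ = Real.exp (-contraction (induction^[n] x)) * (N (n + 1) * N n) := by ring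
        _ ≤ Real.exp (-contraction (induction^[n] x)) *
            (Real.exp (-birkhoffSum induction contraction n x) * N 0 ^ 2) := by gcongr
        _ = _ := by ring
  rw [← hz]
  refine le_of_sq_le_sq ?_ (mul_nonneg (Real.exp_pos _).le (hN0 0))
  calc N (n + 1) ^ 2 ≤ N (n + 1) * N n := by
        rw [sq]
        exact mul_le_mul_of_nonneg_left (hN1 n) (hN0 _)
    _ ≤ _ := hprod n
    _ = (Real.exp (-birkhoffSum induction contraction n x / 2) * N 0) ^ 2 := by
        rw [mul_pow, ← Real.exp_nat_mul]
        congr 2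
        push_cast
        ring

attribute [local instance] Matrix.linftyOpNormedAddCommGroup

theorem exp_mul_le_norm_cocycle (n : ℕ) :
    Real.exp (birkhoffSum induction shrinking n x) * x.2 0 ≤ ‖cocycle (walk x) n‖ := by
  have hy := hx.iterate n
  have h1 := congrFun (cocycle_mulVec hx n) 0
  rw [Matrix.mulVec_smul, Pi.smul_apply, smul_eq_mul] at h1
  have h2 : (cocycle (walk x) n).mulVec (induction^[n] x).2 0 ≤ ‖cocycle (walk x) n‖ := by
    calc ∑ j, cocycle (walk x) n 0 j * (induction^[n] x).2 j
        ≤ ∑ j, ‖cocycle (walk x) n‖ * (induction^[n] x).2 j :=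
          Finset.sum_le_sum fun j _ => mul_le_mul_of_nonneg_right
            ((le_abs_self _).trans (abs_apply_le_norm _ 0 j)) (hy.pos j).le
      _ = ‖cocycle (walk x) n‖ := by rw [← Finset.mul_sum, hy.sum, mul_one]
  rw [← h1]
  calc Real.exp (birkhoffSum induction shrinking n x) *
        (lengthProd x n * (cocycle (walk x) n).mulVec (induction^[n] x).2 0)
      ≤ Real.exp (birkhoffSum induction shrinking n x) *
        (Real.exp (-birkhoffSum induction shrinking n x) * ‖cocycle (walk x) n‖) := by
        refine mul_le_mul_of_nonneg_left ?_ (Real.exp_pos _).le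
        exact mul_le_mul (lengthProd_le_exp hx n) h2
          (pos_of_mul_pos_right (h1 ▸ hx.pos 0) (lengthProd_pos hx n).le).le (Real.exp_pos _).le
    _ = ‖cocycle (walk x) n‖ := by
        rw [← mul_assoc, ← Real.exp_add, add_neg_cancel, Real.exp_zero, one_mul]

/-- A minor of the cocycle on the rows `p`, `q` is `(x.2 q)⁻¹` times a minor of the two rows
`f X` and `q`, where `f = x.2 q • e p - x.2 p • e q` annihilates the lengths. The gauge
only bounds coordinates at the vertex `0`, whence the condition on the walk. -/
theorem exists_abs_minor_le (p q : Fin 3) : ∃ K : ℝ, ∀ n, walk x (n + 1) = 0 →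
    ∀ r s, |cocycle (walk x) (n + 1) p r * cocycle (walk x) (n + 1) q s -
        cocycle (walk x) (n + 1) p s * cocycle (walk x) (n + 1) q r| ≤
      K * (Real.exp (-birkhoffSum induction contraction n x / 2) *
        ‖cocycle (walk x) (n + 1)‖) := by
  -- the combination of `e p` and `e q` that annihilates the lengths
  set f : Fin 3 → ℝ := Pi.single p (x.2 q) - Pi.single q (x.2 p) with hfdef
  have hf : f ⬝ᵥ x.2 = 0 := by
    rw [hfdef, sub_dotProduct, single_dotProduct, single_dotProduct]
    ring
  refine ⟨2 * gauge (walk x 0) f / x.2 q, fun n hn r s => ?_⟩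
  set X := cocycle (walk x) (n + 1) with hX
  set E := Real.exp (-birkhoffSum induction contraction n x / 2) with hE
  have hfX : ∀ j, Matrix.vecMul f X j = x.2 q * X p j - x.2 p * X q j := fun j => by
    rw [hfdef, Matrix.sub_vecMul, Pi.sub_apply, Matrix.single_vecMul, Matrix.single_vecMul]
    simp [Matrix.row]
  have hbound : ∀ j, |Matrix.vecMul f X j| ≤ E * gauge (walk x 0) f := fun j => by
    have h1 := gauge_walk_succ_le_exp hx hf n
    rw [hn] at h1
    exact (abs_le_gauge_zero (hx.iterate (n + 1)).pos
      (dotProduct_vecMul_cocycle hx hf (n + 1)) j).trans h1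
  have hq := hx.pos q
  have hid : x.2 q * (X p r * X q s - X p s * X q r) =
      Matrix.vecMul f X r * X q s - Matrix.vecMul f X s * X q r := by
    rw [hfX, hfX]; ring
  have habs : x.2 q * |X p r * X q s - X p s * X q r| ≤ 2 * gauge (walk x 0) f * (E * ‖X‖) := by
    have h0 := abs_mul (x.2 q) (X p r * X q s - X p s * X q r)
    rw [abs_of_pos hq, hid] at h0
    rw [← h0]
    refine (abs_sub _ _).trans ?_
    rw [abs_mul, abs_mul]
    have h1 := mul_le_mul (hbound r) (abs_apply_le_norm X q s) (abs_nonneg _)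
      (mul_nonneg (Real.exp_pos _).le (gauge_nonneg _ _))
    have h2 := mul_le_mul (hbound s) (abs_apply_le_norm X q r) (abs_nonneg _)
      (mul_nonneg (Real.exp_pos _).le (gauge_nonneg _ _))
    linarith
  rw [div_mul_eq_mul_div, le_div_iff₀ hq]
  linarith

theorem exists_norm_wedgeTwo_cocycle_le : ∃ K : ℝ, 0 < K ∧ ∀ n, walk x (n + 1) = 0 →
    ‖wedgeTwo (cocycle (walk x) (n + 1))‖ ≤
      K * (Real.exp (-birkhoffSum induction contraction n x / 2) *
        ‖cocycle (walk x) (n + 1)‖) := by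
  choose K hK using fun i : Fin 3 => exists_abs_minor_le hx (i.succAbove 0) (i.succAbove 1)
  refine ⟨3 * (∑ i, |K i| + 1), by positivity, fun n hn => ?_⟩
  rw [mul_assoc]
  refine norm_le_of_abs_apply_le fun i j => ?_
  rw [wedgeTwo_apply]
  refine (hK i n hn _ _).trans (mul_le_mul_of_nonneg_right ?_ (by positivity))
  have := Finset.single_le_sum (f := fun i => |K i|) (fun _ _ => abs_nonneg _) (Finset.mem_univ i)
  linarith [le_abs_self (K i)]

theorem first_exponent_pos {l₁ r : ℝ}
    (h₁ : Tendsto (fun n : ℕ => Real.log ‖cocycle (walk x) n‖ / (n : ℝ)) atTop (𝓝 l₁))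
    (hr : Tendsto (fun n : ℕ => birkhoffSum induction shrinking n x / (n : ℝ)) atTop (𝓝 r))
    (hr0 : 0 < r) : 0 < l₁ := by
  refine hr0.trans_le ?_
  have h3 := hr.add (tendsto_const_div_atTop_nhds_zero_nat (Real.log (x.2 0)))
  rw [add_zero] at h3
  refine le_of_tendsto_of_tendsto' h3 h₁ fun n => ?_
  have h0 := hx.pos 0
  rw [← add_div]
  refine div_le_div_of_nonneg_right ?_ n.cast_nonneg
  rw [← Real.log_exp (birkhoffSum induction shrinking n x),
    ← Real.log_mul (Real.exp_pos _).ne' h0.ne']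
  exact Real.log_le_log (by positivity) (exp_mul_le_norm_cocycle hx n)

theorem second_exponent_neg {l₁ l₁₂ c : ℝ}
    (h₁ : Tendsto (fun n : ℕ => Real.log ‖cocycle (walk x) n‖ / (n : ℝ)) atTop (𝓝 l₁))
    (h₂ : Tendsto (fun n : ℕ => Real.log ‖wedgeTwo (cocycle (walk x) n)‖ / (n : ℝ)) atTop (𝓝 l₁₂))
    (hc : Tendsto (fun n : ℕ => birkhoffSum induction contraction n x / (n : ℝ)) atTop (𝓝 c))
    (hc0 : 0 < c) : l₁₂ - l₁ < 0 := by
  obtain ⟨K, hK0, hK⟩ := exists_norm_wedgeTwo_cocycle_le hx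
  have hlim := ((h₂.sub h₁).add (hc.div_const 2)).sub
    (tendsto_const_div_atTop_nhds_zero_nat (Real.log K + 1 / 2))
  rw [sub_zero] at hlim
  have hfr : ∃ᶠ n in atTop, Real.log ‖wedgeTwo (cocycle (walk x) n)‖ / (n : ℝ) -
      Real.log ‖cocycle (walk x) n‖ / (n : ℝ) +
        birkhoffSum induction contraction n x / (n : ℝ) / 2 -
      (Real.log K + 1 / 2) / (n : ℝ) ≤ 0 := by
    refine (hx.frequently_walk_eq_zero.and_eventually (eventually_ge_atTop 1)).mono ?_
    rintro n ⟨hn, hn1⟩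
    obtain ⟨n, rfl⟩ := Nat.exists_eq_add_of_le' hn1
    have h1 := zero_lt_one.trans_le (one_le_norm_cocycle (walk x) (n + 1))
    have h2 := zero_lt_one.trans_le (one_le_norm_wedgeTwo_cocycle (walk x) (n + 1))
    have h3 := Real.log_le_log h2 (hK n hn)
    rw [Real.log_mul hK0.ne' (by positivity), Real.log_mul (Real.exp_pos _).ne' h1.ne',
      Real.log_exp] at h3
    have h4 := contraction_le_one (induction^[n] x)
    rw [birkhoffSum_succ, div_right_comm, ← sub_div, ← add_div, ← sub_div]
    refine div_nonpos_of_nonpos_of_nonneg ?_ (Nat.cast_nonneg _)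
    linarith
  have := le_of_tendsto_of_frequently hlim hfr
  linarith

end Exponents

end ARC

end

theorem theorem3 (μ : MeasureTheory.Measure ARC.State) (hμ : ARC.IsNaturalMeasure μ) :
    (∀ᵐ w ∂(ARC.walkMeasure μ), ∃ l₁ l₂ l₃ : ℝ,
      ARC.HasLyapunovExponents w l₁ l₂ l₃ ∧ 0 < l₁ ∧ l₂ < 0) ∧
    (Ergodic ARC.induction μ → ∃ l₁ l₂ l₃ : ℝ, 0 < l₁ ∧ l₂ < 0 ∧
      ∀ᵐ w ∂(ARC.walkMeasure μ), ARC.HasLyapunovExponents w l₁ l₂ l₃) := by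
  have hprob := hμ.prob
  have hT := hμ.invariant
  have hwalk : MeasurePreserving ARC.walk μ (ARC.walkMeasure μ) :=
    ARC.measurable_walk.measurePreserving μ
  have hprob' : IsProbabilityMeasure (ARC.walkMeasure μ) :=
    Measure.isProbabilityMeasure_map ARC.measurable_walk.aemeasurable
  have hsemi : Function.Semiconj ARC.walk ARC.induction ARC.shift := fun _ => rfl
  have hshift : MeasurePreserving ARC.shift (ARC.walkMeasure μ) (ARC.walkMeasure μ) :=
    hwalk.of_semiconj hT hsemi ARC.measurable_shift
  obtain ⟨C₁, hg₁⟩ := ARC.exists_isSubadditiveProcess (F := id) (fun _ _ => rfl) rfl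
    ARC.one_le_norm_cocycle
  obtain ⟨C₂, hg₂⟩ := ARC.exists_isSubadditiveProcess ARC.wedgeTwo_mul ARC.wedgeTwo_one
    ARC.one_le_norm_wedgeTwo_cocycle
  obtain ⟨L₁, hL₁, hinv₁, hlim₁⟩ := hg₁.exists_limit hshift
  obtain ⟨L₂, hL₂, hinv₂, hlim₂⟩ := hg₂.exists_limit hshift
  have hgood : ∀ᵐ x ∂μ, ARC.IsInfiniteType x := by
    filter_upwards [hμ.ae_mem] with x hx using ARC.isInfiniteType_of_mem_gasket hx
  have hsign : ∀ᵐ w ∂(ARC.walkMeasure μ), 0 < L₁ w ∧ L₂ w - L₁ w < 0 := by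
    have hmeas : MeasurableSet {w | 0 < L₁ w ∧ L₂ w - L₁ w < 0} :=
      (measurableSet_lt measurable_const hL₁).inter
        (measurableSet_lt (hL₂.sub hL₁) measurable_const)
    rw [ARC.walkMeasure, ae_map_iff ARC.measurable_walk.aemeasurable hmeas]
    filter_upwards [hgood, hwalk.quasiMeasurePreserving.ae hlim₁,
      hwalk.quasiMeasurePreserving.ae hlim₂,
      ARC.ae_tendsto_birkhoffSum_pos hT ARC.measurable_shrinking ARC.shrinking_nonneg
        ARC.shrinking_le_one (hgood.mono fun x hx => ⟨0, ARC.shrinking_pos hx⟩),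
      ARC.ae_tendsto_birkhoffSum_pos hT ARC.measurable_contraction ARC.contraction_nonneg
        ARC.contraction_le_one (hgood.mono fun x hx => ARC.exists_contraction_pos hx)]
      with x hx h₁ h₂ ⟨r, hr0, hr⟩ ⟨c, hc0, hc⟩
    exact ⟨ARC.first_exponent_pos hx h₁ hr hr0, ARC.second_exponent_neg hx h₁ h₂ hc hc0⟩
  have hexp : ∀ᵐ w ∂(ARC.walkMeasure μ),
      ARC.HasLyapunovExponents w (L₁ w) (L₂ w - L₁ w) (-L₂ w) := by
    filter_upwards [hlim₁, hlim₂] with w h₁ h₂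
    exact ⟨h₁, by rwa [add_sub_cancel], by rw [add_sub_cancel]⟩
  refine ⟨?_, fun herg => ?_⟩
  · filter_upwards [hsign, hexp] with w hs he using ⟨_, _, _, he, hs.1, hs.2⟩
  · have herg' : Ergodic ARC.shift (ARC.walkMeasure μ) :=
      hwalk.ergodic_of_ergodic_semiconj herg ARC.measurable_shift hsemi
    obtain ⟨c₁, hc₁⟩ := herg'.ae_eq_const_of_ae_eq_comp_ae hL₁.aestronglyMeasurable hinv₁
    obtain ⟨c₂, hc₂⟩ := herg'.ae_eq_const_of_ae_eq_comp_ae hL₂.aestronglyMeasurable hinv₂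
    have hall : ∀ᵐ w ∂(ARC.walkMeasure μ),
        ARC.HasLyapunovExponents w c₁ (c₂ - c₁) (-c₂) ∧ 0 < c₁ ∧ c₂ - c₁ < 0 := by
      filter_upwards [hsign, hexp, hc₁, hc₂] with w hs he h₁ h₂
      rw [h₁, h₂] at hs he
      exact ⟨he, hs⟩
    obtain ⟨w, -, h₁, h₂⟩ := hall.exists
    exact ⟨c₁, c₂ - c₁, -c₂, h₁, h₂, hall.mono fun w hw => hw.1⟩
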